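/- Let $\delta>-2$ be real. For real $u>1$ and an integer $n\ge 1$ let $T_1,\dots,T_n\in[0,1]$ (the transmission eigenvalues, symmetry index $\beta=2$, with $n$ and $m=un$ channels in the two leads) be distributed with joint density $$\frac1C\prod_{j=1}^n T_j^{\,n(u-1)}(1-T_j)^{\delta/2}\prod_{1\le j<l\le n}|T_l-T_j|^2,$$ where $0<C<\infty$ is the normalisation constant, and let $M(k,n)=\langle T_1^k+\dots+T_n^k\rangle$. Then for every integer $k\ge 0$ there is an asymptotic expansion, as $n\to\infty$ with $u$ and $\delta$ fixed, $$\frac1n M(k,n)\sim\sum_{p=0}^{\infty}\mathcal T^{(2,\delta)}_{k,p}(u)\,n^{-p},$$ and the generating function of the coefficients of $n^{-2}$ is, for every $u>1$ and all complex $s$ with $|s|<1$ (principal branches of the powers), $$\sum_{k=1}^{\infty}\mathcal T^{(2,\delta)}_{k,2}(u)\,s^k=\frac{\delta^{2}us\bigl((u+1)^{2}-s(u-1)^{2}\bigr)-4s^{2}u^{2}}{4(1-s)^{3/2}\bigl((u+1)^{2}-s(u-1)^{2}\bigr)^{5/2}}.$$ -/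

import Mathlib

open Filter MeasureTheory

/-- The unnormalised Jacobi (Selberg) density
`∏ⱼ xⱼ^{(β/2)(b+1)-1} (1-xⱼ)^{(β/2)(a+1)-1} ∏_{j<l} |x_l - xⱼ|^β`. -/
noncomputable def jacobiWeight (β a b : ℝ) (n : ℕ) (x : Fin n → ℝ) : ℝ :=
  (∏ j, x j ^ (β / 2 * (b + 1) - 1) * (1 - x j) ^ (β / 2 * (a + 1) - 1)) *
    ∏ j, ∏ l ∈ Finset.Ioi j, |x l - x j| ^ β

/-- The cube `[0,1]^n`. -/
def unitCube (n : ℕ) : Set (Fin n → ℝ) := Set.Icc 0 1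

/-- The normalisation constant `C` of the Jacobi density. -/
noncomputable def jacobiNorm (β a b : ℝ) (n : ℕ) : ℝ :=
  ∫ x in unitCube n, jacobiWeight β a b n x

/-- The moment `⟨x₁^k + ⋯ + xₙ^k⟩` with respect to the normalised Jacobi density. -/
noncomputable def jacobiMoment (β a b : ℝ) (k n : ℕ) : ℝ :=
  1 / jacobiNorm β a b n *
    ∫ x in unitCube n, (∑ j, x j ^ k) * jacobiWeight β a b n x

/-- The parameter `a = (2/β)(1 + δ/2) - 1`. -/
noncomputable def paramA (β δ : ℝ) : ℝ := 2 / β * (1 + δ / 2) - 1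

/-- The parameter `b = m - n` with `m = u n`. -/
def paramB (u : ℝ) (n : ℕ) : ℝ := u * n - n

/-- The `k`-th moment of the `n` transmission eigenvalues of a cavity whose leads have `n` and
`m = u n` channels. -/
noncomputable def transmissionMoment (β δ u : ℝ) (k n : ℕ) : ℝ :=
  jacobiMoment β (paramA β δ) (paramB u n) k n

/-- Poincaré asymptotic expansion `f n ∼ ∑ₚ c p n^{-p}` as `n → ∞`. -/
def HasAsymptoticExpansion (f : ℕ → ℝ) (c : ℕ → ℝ) : Prop :=
  ∀ P : ℕ, (fun n : ℕ => f n - ∑ p ∈ Finset.range (P + 1), c p / (n : ℝ) ^ p)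
    =o[atTop] (fun n : ℕ => 1 / (n : ℝ) ^ P)

/-! For `β = 2` the squared Vandermonde product is the squared determinant of the monic polynomials
orthogonal for x^b (1-x)^a, with a = δ/2 and b = (u-1)n. Orthogonality then reduces M(k,n) to a sum
of one-variable integrals (`jacobiMoment_two`).

By the Christoffel–Darboux formula and an integration by parts, the difference D_k = M(k,n) -
M(k+1,n) is, up to explicit factors, k⁻¹ times the k-th moment of the product of the polynomials of
degrees n and n-1 (k ≥ 1). Both are eigenfunctions of the Jacobi operator, so the moments of their
product obey a three-term recurrence (`IsJacobiFunctional.eigen_product_recurrence`), and D_k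
inherits one (`IsJacobiFunctional.densityMoment_recurrence`). This part uses only the Pearson
equation and positivity.

Put N = 2n+a+b = (u+1)n+a. Divided by n², the recurrence has coefficients quadratic in 1/n and a
leading coefficient with nonzero limit, so expansions of D_k/n propagate from k = 0, 1
(`expandsAs_momentDiffSeries`). The orders n⁰, n⁻¹, n⁻² give three recurrences with one homogeneous
part, each forced by the lower orders. As generating functions they are linear differential
equations, solved in closed form in Y = ((1-s)((u+1)² - s(u-1)²))^(-1/2) by `genZero`, `genOne`,
`genTwo`; the values at k = 0, 1 fix the solution (`coeff_momentDiffSeries`). Undoing the difference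
in k divides by s - 1 (`coeff_two_momentSeries`), and binomial series give convergence on the unit
disc (`hasSum_coeff_genTwo`). -/

open Polynomial in
/-- The Jacobi differential operator `x(1-x) f'' + (b+1-(a+b+2)x) f'`. -/
noncomputable def jacobiOp (a b : ℝ) (f : ℝ[X]) : ℝ[X] :=
  X * (1 - X) * derivative (derivative f) + (C (b + 1) - C (a + b + 2) * X) * derivative f

/-- The eigenvalues of the Jacobi differential operator. -/
def jacobiEigenvalue (a b : ℝ) (n : ℕ) : ℝ := -(n * (n + a + b + 1))

/-- The coefficients of the monic Jacobi polynomial on `[0,1]`. -/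
noncomputable def jacobiCoeff (a b : ℝ) (n j : ℕ) : ℝ :=
  if j ≤ n then ∏ i ∈ Finset.Ico j n,
    ((i + 1) * (i + b + 1)) / (jacobiEigenvalue a b n - jacobiEigenvalue a b i) else 0

open Polynomial in
/-- The monic Jacobi polynomial for the weight `x^b (1-x)^a` on `[0,1]`. -/
noncomputable def jacobiPoly (a b : ℝ) (n : ℕ) : ℝ[X] :=
  ∑ j ∈ Finset.range (n + 1), monomial j (jacobiCoeff a b n j)

open Polynomial in
/-- A positive linear functional on polynomials satisfying the Pearson equation of the Jacobi
weight `x^b (1-x)^a`. -/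
structure IsJacobiFunctional (a b : ℝ) (l : ℝ[X] →ₗ[ℝ] ℝ) : Prop where
  pearson : ∀ f : ℝ[X],
    l (X * (1 - X) * derivative f + (C (b + 1) - C (a + b + 2) * X) * f) = 0
  pos : ∀ f : ℝ[X], f ≠ 0 → 0 < l (f * f)

/-! ### Monic Jacobi polynomials: eigenvalue equation, orthogonality, three-term recurrence. -/

section Algebra

open Polynomial

variable {a b : ℝ} {l : ℝ[X] →ₗ[ℝ] ℝ}

theorem jacobiEigenvalue_sub_ne_zero (hs : -1 < a + b) {n i : ℕ} (h : i < n) :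
    jacobiEigenvalue a b n - jacobiEigenvalue a b i ≠ 0 := by
  have h1 : (i : ℝ) + 1 ≤ n := by exact_mod_cast h
  have h2 : (0 : ℝ) ≤ i := i.cast_nonneg
  have : jacobiEigenvalue a b n - jacobiEigenvalue a b i = -((n - i) * (n + i + a + b + 1)) := by
    simp only [jacobiEigenvalue]; ring
  rw [this, neg_ne_zero]
  exact mul_ne_zero (by linarith) (by linarith)

theorem jacobiCoeff_self (n : ℕ) : jacobiCoeff a b n n = 1 := by simp [jacobiCoeff]

theorem jacobiCoeff_of_lt {n j : ℕ} (h : n < j) : jacobiCoeff a b n j = 0 := by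
  simp [jacobiCoeff, not_le.2 h]

/-- This is the eigenvalue equation read on coefficients. It holds at `j = n` too, where the
eigenvalue difference vanishes. -/
theorem jacobiCoeff_succ (hs : -1 < a + b) (n j : ℕ) :
    (j + 1) * (j + b + 1) * jacobiCoeff a b n (j + 1) =
      (jacobiEigenvalue a b n - jacobiEigenvalue a b j) * jacobiCoeff a b n j := by
  rcases lt_trichotomy j n with h | h | h
  · have := jacobiEigenvalue_sub_ne_zero hs h
    rw [jacobiCoeff, jacobiCoeff, if_pos (Nat.succ_le_of_lt h), if_pos h.le,
      Finset.prod_eq_prod_Ico_succ_bot h]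
    field_simp
  · subst h; simp [jacobiCoeff]
  · simp [jacobiCoeff_of_lt h, jacobiCoeff_of_lt (h.trans (Nat.lt_succ_self j))]

theorem coeff_jacobiPoly (n j : ℕ) : (jacobiPoly a b n).coeff j = jacobiCoeff a b n j := by
  simp only [jacobiPoly, finsetSum_coeff, coeff_monomial, Finset.sum_ite_eq', Finset.mem_range]
  split_ifs with h
  · rfl
  · rw [jacobiCoeff_of_lt (by omega)]

theorem natDegree_jacobiPoly (n : ℕ) : (jacobiPoly a b n).natDegree = n := by
  refine natDegree_eq_of_le_of_coeff_ne_zero ?_ ?_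
  · rw [natDegree_le_iff_coeff_eq_zero]
    intro j hj
    rw [coeff_jacobiPoly, jacobiCoeff_of_lt hj]
  · simp [coeff_jacobiPoly, jacobiCoeff_self]

theorem monic_jacobiPoly (n : ℕ) : (jacobiPoly a b n).Monic := by
  rw [Monic, leadingCoeff, natDegree_jacobiPoly, coeff_jacobiPoly, jacobiCoeff_self]

/-- The operator is bidiagonal on monomials, which is why its eigenvectors have product
coefficients. -/
theorem coeff_jacobiOp (f : ℝ[X]) (j : ℕ) :
    (jacobiOp a b f).coeff j =
      (j + 1) * (j + b + 1) * f.coeff (j + 1) + jacobiEigenvalue a b j * f.coeff j := by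
  have : jacobiOp a b f = X * derivative (derivative f) - X * (X * derivative (derivative f))
      + C (b + 1) * derivative f - C (a + b + 2) * (X * derivative f) := by
    rw [jacobiOp]; ring
  rw [this]
  rcases j with _ | _ | j <;>
  simp only [coeff_add, coeff_sub, coeff_C_mul, coeff_X_mul, coeff_derivative, coeff_X_mul_zero,
    jacobiEigenvalue] <;> push_cast <;> ring

theorem jacobiOp_jacobiPoly (hs : -1 < a + b) (n : ℕ) :
    jacobiOp a b (jacobiPoly a b n) = C (jacobiEigenvalue a b n) * jacobiPoly a b n := by
  ext j
  rw [coeff_jacobiOp, coeff_C_mul, coeff_jacobiPoly, coeff_jacobiPoly, jacobiCoeff_succ hs]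
  ring

/-- The second highest coefficient of the monic Jacobi polynomial. -/
noncomputable def jacobiSubleading (a b : ℝ) (n : ℕ) : ℝ := -(n * (n + b)) / (2 * n + a + b)

theorem jacobiCoeff_succ_self (hs : -1 < a + b) (n : ℕ) :
    jacobiCoeff a b (n + 1) n = jacobiSubleading a b (n + 1) := by
  have h := jacobiCoeff_succ hs (n + 1) n
  have hn : (0 : ℝ) ≤ n := n.cast_nonneg
  rw [jacobiCoeff_self] at h
  have : 2 * ((n : ℝ) + 1) + a + b ≠ 0 := by linarith
  rw [jacobiSubleading]
  push_cast
  rw [eq_div_iff this]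
  simp only [jacobiEigenvalue] at h
  push_cast at h
  linear_combination h

theorem jacobiCoeff_add_two_self (hs : -1 < a + b) (n : ℕ) :
    jacobiCoeff a b (n + 2) n = (n + 1) * (n + 1 + b) * (n + 2) * (n + 2 + b) /
      (2 * (2 * n + 4 + a + b) * (2 * n + 3 + a + b)) := by
  have h := jacobiCoeff_succ hs (n + 2) n
  have hn : (0 : ℝ) ≤ n := n.cast_nonneg
  rw [jacobiCoeff_succ_self hs, jacobiSubleading] at h
  have h1 : 2 * (n : ℝ) + 4 + a + b ≠ 0 := by linarith
  have h2 : 2 * (n : ℝ) + 3 + a + b ≠ 0 := by linarith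
  have h3 : 2 * ((n + 1 + 1 : ℕ) : ℝ) + a + b = 2 * (n : ℝ) + 4 + a + b := by push_cast; ring
  have h4 : jacobiEigenvalue a b (n + 2) - jacobiEigenvalue a b n
      = -2 * (2 * (n : ℝ) + 3 + a + b) := by
    simp only [jacobiEigenvalue]; push_cast; ring
  rw [h3, h4] at h
  push_cast at h
  rw [eq_div_iff (mul_ne_zero (mul_ne_zero two_ne_zero h1) h2)]
  generalize hp : 2 * (n : ℝ) + 4 + a + b = p at *
  generalize hq : 2 * (n : ℝ) + 3 + a + b = q at *
  field_simp at h
  linear_combination h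

/-- Subtract the Pearson equations for f'g and fg': the terms in x(1-x)f'g' cancel. -/
theorem IsJacobiFunctional.symm (hl : IsJacobiFunctional a b l) (f g : ℝ[X]) :
    l (jacobiOp a b f * g) = l (f * jacobiOp a b g) := by
  have h1 := hl.pearson (derivative f * g)
  have h2 := hl.pearson (f * derivative g)
  rw [← sub_eq_zero, ← map_sub, ← sub_eq_zero.2 (h1.trans h2.symm), ← map_sub]
  congr 1
  simp only [jacobiOp, derivative_mul]
  ring

theorem IsJacobiFunctional.orthogonal (hl : IsJacobiFunctional a b l) (hs : -1 < a + b) {m n : ℕ}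
    (h : m ≠ n) : l (jacobiPoly a b m * jacobiPoly a b n) = 0 := by
  have h1 := hl.symm (jacobiPoly a b m) (jacobiPoly a b n)
  rw [jacobiOp_jacobiPoly hs, jacobiOp_jacobiPoly hs, mul_assoc, mul_left_comm (jacobiPoly a b m),
    ← smul_eq_C_mul, ← smul_eq_C_mul, map_smul, map_smul, smul_eq_mul, smul_eq_mul,
    ← sub_eq_zero, ← sub_mul] at h1
  refine (mul_eq_zero.1 h1).resolve_left ?_
  rcases h.lt_or_gt with h | h
  · rw [← neg_eq_zero, neg_sub]
    exact jacobiEigenvalue_sub_ne_zero hs h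
  · exact jacobiEigenvalue_sub_ne_zero hs h

/-- The squared norm of the monic Jacobi polynomial. -/
noncomputable def jacobiSqNorm (a b : ℝ) (l : ℝ[X] →ₗ[ℝ] ℝ) (n : ℕ) : ℝ :=
  l (jacobiPoly a b n * jacobiPoly a b n)

theorem IsJacobiFunctional.sqNorm_pos (hl : IsJacobiFunctional a b l) (n : ℕ) :
    0 < jacobiSqNorm a b l n := hl.pos _ (monic_jacobiPoly n).ne_zero

/-- The polynomials are monic of every degree, so the top term of `q` can be removed and the degree
lowered. Keeping `r` arbitrary lets the lemma serve again for the remainder in `three_term`. -/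
theorem map_mul_eq_zero_of_forall_jacobiPoly {r : ℝ[X]} {n : ℕ}
    (h : ∀ j < n, l (r * jacobiPoly a b j) = 0) (q : ℝ[X]) (hq : ∀ m, n ≤ m → q.coeff m = 0) :
    l (r * q) = 0 := by
  induction n generalizing q with
  | zero =>
    have : q = 0 := by ext m; simpa using hq m (Nat.zero_le m)
    simp [this]
  | succ n ih =>
    have h1 := ih (fun j hj => h j (hj.trans n.lt_succ_self))
      (q - C (q.coeff n) * jacobiPoly a b n) (fun m hm => by
        rw [coeff_sub, coeff_C_mul, coeff_jacobiPoly]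
        rcases hm.eq_or_lt with rfl | hm
        · simp [jacobiCoeff_self]
        · simp [jacobiCoeff_of_lt hm, hq m hm])
    rw [mul_sub, map_sub, mul_left_comm, ← smul_eq_C_mul, map_smul, h n n.lt_succ_self,
      smul_zero, sub_zero] at h1
    exact h1

theorem IsJacobiFunctional.map_jacobiPoly_mul (hl : IsJacobiFunctional a b l) (hs : -1 < a + b)
    (n : ℕ) (q : ℝ[X]) (hq : ∀ m, n ≤ m → q.coeff m = 0) : l (jacobiPoly a b n * q) = 0 :=
  map_mul_eq_zero_of_forall_jacobiPoly (fun _ hj => hl.orthogonal hs hj.ne') q hq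

theorem coeff_X_mul_jacobiPoly (n m : ℕ) :
    (X * jacobiPoly a b n).coeff (m + 1) = jacobiCoeff a b n m := by
  rw [coeff_X_mul, coeff_jacobiPoly]

/-- The multiple of π_n subtracted from xπ_n - π_{n+1} is the one that leaves degree below n, and
π_n annihilates such a remainder. -/
theorem IsJacobiFunctional.map_X_mul_sq (hl : IsJacobiFunctional a b l) (hs : -1 < a + b)
    (n : ℕ) : l (X * (jacobiPoly a b n * jacobiPoly a b n)) =
      (jacobiSubleading a b n - jacobiSubleading a b (n + 1)) * jacobiSqNorm a b l n := by
  have h := hl.map_jacobiPoly_mul hs n (X * jacobiPoly a b n - jacobiPoly a b (n + 1)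
    - C (jacobiSubleading a b n - jacobiSubleading a b (n + 1)) * jacobiPoly a b n) (fun m hm => by
      rw [coeff_sub, coeff_sub, coeff_C_mul, coeff_jacobiPoly, coeff_jacobiPoly]
      rcases hm.eq_or_lt with rfl | hm
      · rcases n with _ | n
        · simp [jacobiCoeff_self, jacobiCoeff_succ_self hs, jacobiSubleading]
        · rw [coeff_X_mul_jacobiPoly]
          simp [jacobiCoeff_self, jacobiCoeff_succ_self hs]
      · obtain ⟨m, rfl⟩ := Nat.exists_eq_succ_of_ne_zero (Nat.ne_zero_of_lt hm)
        rw [Nat.succ_eq_add_one, coeff_X_mul_jacobiPoly, jacobiCoeff_of_lt hm]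
        rcases (Nat.le_of_lt_succ hm).eq_or_lt with rfl | hm
        · simp [jacobiCoeff_self]
        · simp [jacobiCoeff_of_lt hm, jacobiCoeff_of_lt (Nat.succ_lt_succ hm)])
  rw [mul_sub, mul_sub, map_sub, map_sub, mul_left_comm _ (C _), ← smul_eq_C_mul, map_smul,
    hl.orthogonal hs (Nat.lt_succ_self n).ne, sub_zero, mul_left_comm] at h
  rw [jacobiSqNorm]
  exact sub_eq_zero.1 h

theorem IsJacobiFunctional.map_X_mul_mul_succ (hl : IsJacobiFunctional a b l) (hs : -1 < a + b)
    (n : ℕ) : l (X * (jacobiPoly a b (n + 1) * jacobiPoly a b n)) = jacobiSqNorm a b l (n + 1) := by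
  have h := hl.map_jacobiPoly_mul hs (n + 1) (X * jacobiPoly a b n - jacobiPoly a b (n + 1))
    (fun m hm => by
      obtain ⟨m, rfl⟩ := Nat.exists_eq_succ_of_ne_zero (Nat.ne_zero_of_lt hm)
      rw [coeff_sub, Nat.succ_eq_add_one, coeff_X_mul_jacobiPoly, coeff_jacobiPoly]
      rcases (Nat.le_of_succ_le_succ hm).eq_or_lt with rfl | hm
      · simp [jacobiCoeff_self]
      · simp [jacobiCoeff_of_lt hm, jacobiCoeff_of_lt (Nat.succ_lt_succ hm)])
  rw [mul_sub, map_sub, mul_left_comm] at h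
  exact sub_eq_zero.1 h

/-- The three-term recurrence of the monic Jacobi polynomials. -/
theorem IsJacobiFunctional.three_term (hl : IsJacobiFunctional a b l) (hs : -1 < a + b) (n : ℕ) :
    X * jacobiPoly a b (n + 1) = jacobiPoly a b (n + 2)
      + C (jacobiSubleading a b (n + 1) - jacobiSubleading a b (n + 2)) * jacobiPoly a b (n + 1)
      + C (jacobiSqNorm a b l (n + 1) / jacobiSqNorm a b l n) * jacobiPoly a b n := by
  set α := jacobiSubleading a b (n + 1) - jacobiSubleading a b (n + 2) with hα
  set β := jacobiSqNorm a b l (n + 1) / jacobiSqNorm a b l n with hβ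
  set r := X * jacobiPoly a b (n + 1) - jacobiPoly a b (n + 2) - C α * jacobiPoly a b (n + 1)
    - C β * jacobiPoly a b n with hr
  suffices h : r = 0 by
    rw [hr] at h
    linear_combination h
  -- The remainder has degree below n+2 and is orthogonal to every π_j with j < n+2. Hence it is
  -- orthogonal to itself, and positivity forces it to vanish.
  have hort : ∀ j < n + 2, l (r * jacobiPoly a b j) = 0 := by
    intro j hj
    have e : r * jacobiPoly a b j = X * (jacobiPoly a b (n + 1) * jacobiPoly a b j)
        - jacobiPoly a b (n + 2) * jacobiPoly a b j
        - α • (jacobiPoly a b (n + 1) * jacobiPoly a b j)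
        - β • (jacobiPoly a b n * jacobiPoly a b j) := by
      rw [hr, smul_eq_C_mul, smul_eq_C_mul]; ring
    rw [e, map_sub, map_sub, map_sub, map_smul, map_smul, hl.orthogonal hs hj.ne']
    rcases (Nat.le_of_lt_succ hj).eq_or_lt with rfl | hj
    · rw [hl.map_X_mul_sq hs, hl.orthogonal hs (Nat.lt_succ_self n).ne, jacobiSqNorm]
      simp [hα]
    rcases (Nat.le_of_lt_succ hj).eq_or_lt with rfl | hj
    · rw [hl.map_X_mul_mul_succ hs, hl.orthogonal hs (Nat.lt_succ_self j).ne']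
      have := (hl.sqNorm_pos j).ne'
      rw [← jacobiSqNorm, hβ]
      simp only [smul_eq_mul, mul_zero, sub_zero]
      rw [div_mul_cancel₀ _ this, sub_self]
    · rw [hl.orthogonal hs (hj.trans n.lt_succ_self).ne', hl.orthogonal hs hj.ne', mul_left_comm,
        hl.map_jacobiPoly_mul hs (n + 1)]
      · simp
      · intro m hm
        obtain ⟨m, rfl⟩ := Nat.exists_eq_succ_of_ne_zero (Nat.ne_zero_of_lt hm)
        rw [Nat.succ_eq_add_one, coeff_X_mul_jacobiPoly, jacobiCoeff_of_lt (by omega)]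
  by_contra h0
  refine (hl.pos r h0).ne' (map_mul_eq_zero_of_forall_jacobiPoly hort r fun m hm => ?_)
  obtain ⟨m, rfl⟩ := Nat.exists_eq_succ_of_ne_zero (Nat.ne_zero_of_lt hm)
  rw [hr, coeff_sub, coeff_sub, coeff_sub, coeff_C_mul, coeff_C_mul, Nat.succ_eq_add_one,
    coeff_X_mul_jacobiPoly, coeff_jacobiPoly, coeff_jacobiPoly, coeff_jacobiPoly,
    jacobiCoeff_of_lt (show n < m + 1 by omega), jacobiCoeff_of_lt (show n + 1 < m + 1 by omega)]
  rcases (Nat.le_of_succ_le_succ hm).eq_or_lt with rfl | hm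
  · simp [jacobiCoeff_self]
  · simp [jacobiCoeff_of_lt hm, jacobiCoeff_of_lt (Nat.succ_lt_succ hm)]

/-- The ratio of consecutive squared norms. -/
theorem IsJacobiFunctional.sqNorm_succ_div (hl : IsJacobiFunctional a b l) (hs : -1 < a + b)
    (n : ℕ) : jacobiSqNorm a b l (n + 1) / jacobiSqNorm a b l n =
      (n + 1) * (n + 1 + a) * (n + 1 + b) * (n + 1 + a + b) /
        ((2 * n + 2 + a + b) ^ 2 * ((2 * n + 2 + a + b) ^ 2 - 1)) := by
  -- The coefficient of X^n in the three-term recurrence gives the norm ratio from the two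
  -- coefficients below the leading one, without evaluating any norm.
  have h := congrArg (fun p => coeff p n) (hl.three_term hs n)
  simp only [coeff_add, coeff_C_mul, coeff_jacobiPoly, jacobiCoeff_self, mul_one] at h
  rw [jacobiCoeff_succ_self hs, jacobiCoeff_add_two_self hs] at h
  have hn : (0 : ℝ) ≤ n := n.cast_nonneg
  have h1 : 2 * (n : ℝ) + 4 + a + b ≠ 0 := by linarith
  have h2 : 2 * (n : ℝ) + 3 + a + b ≠ 0 := by linarith
  have h3 : 2 * (n : ℝ) + 2 + a + b ≠ 0 := by linarith
  have h4 : 2 * (n : ℝ) + 1 + a + b ≠ 0 := by linarith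
  have e : (X * jacobiPoly a b (n + 1)).coeff n = n * (n + b) * (n + 1) * (n + 1 + b) /
      (2 * (2 * n + 2 + a + b) * (2 * n + 1 + a + b)) := by
    rcases n with _ | n
    · simp
    · rw [coeff_X_mul_jacobiPoly, jacobiCoeff_add_two_self hs]
      push_cast
      congr 1 <;> ring
  rw [e] at h
  have h5 : (2 * (n : ℝ) + 2 + a + b) ^ 2 - 1 =
      (2 * (n : ℝ) + 1 + a + b) * (2 * (n : ℝ) + 3 + a + b) := by ring
  rw [h5]
  simp only [jacobiSubleading] at h
  push_cast at h
  rw [show 2 * ((n : ℝ) + 1) + a + b = 2 * (n : ℝ) + 2 + a + b by ring,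
    show 2 * ((n : ℝ) + 2) + a + b = 2 * (n : ℝ) + 4 + a + b by ring] at h
  rw [← sub_eq_iff_eq_add'] at h
  rw [← h]
  generalize hp : 2 * (n : ℝ) + 4 + a + b = p at *
  generalize hq : 2 * (n : ℝ) + 3 + a + b = q at *
  generalize hr : 2 * (n : ℝ) + 2 + a + b = r at *
  generalize ht : 2 * (n : ℝ) + 1 + a + b = t at *
  field_simp
  obtain rfl : q = t + 2 := by linarith
  obtain rfl : r = t + 1 := by linarith
  obtain rfl : p = t + 3 := by linarith
  obtain rfl : a = t - 2 * n - 1 - b := by linarith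
  ring

end Algebra

/-! ### Recurrence in k for the differences of moments. -/

section MomentRecurrence

open Polynomial

variable {a b : ℝ} {l : ℝ[X] →ₗ[ℝ] ℝ}

theorem map_C_mul_eq (l : ℝ[X] →ₗ[ℝ] ℝ) (c : ℝ) (f : ℝ[X]) : l (C c * f) = c * l f := by
  rw [← smul_eq_C_mul, map_smul, smul_eq_mul]

theorem IsJacobiFunctional.pearson_X_pow_succ (hl : IsJacobiFunctional a b l) (k : ℕ) (g : ℝ[X]) :
    l (X ^ (k + 1) * (X * (1 - X) * derivative g + (C (b + 1) - C (a + b + 2) * X) * g)) =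
      -((k + 1) * l (X ^ k * (X * (1 - X)) * g)) := by
  rw [← map_C_mul_eq, ← map_neg, ← sub_eq_zero, ← map_sub, ← hl.pearson (X ^ (k + 1) * g)]
  congr 1
  rw [derivative_mul, derivative_X_pow]
  simp only [Nat.add_sub_cancel, C_add, C_1, Nat.cast_add, Nat.cast_one, map_natCast]
  ring

/-- Here the derivative of x^k is absorbed through x(x^k)' = k x^k, which also covers `k = 0`. -/
theorem IsJacobiFunctional.pearson_X_pow (hl : IsJacobiFunctional a b l) (k : ℕ) (g : ℝ[X]) :
    (k + b + 1) * l (X ^ k * g) - (k + a + b + 2) * l (X ^ (k + 1) * g)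
      + l (X ^ k * (X * (1 - X)) * derivative g) = 0 := by
  rw [← map_C_mul_eq, ← map_C_mul_eq, ← map_sub, ← map_add, ← hl.pearson (X ^ k * g)]
  congr 1
  have : X * derivative (X ^ k : ℝ[X]) = C (k : ℝ) * X ^ k := by
    rcases k with _ | k
    · simp
    · rw [derivative_X_pow]; simp only [Nat.add_sub_cancel]; ring
  rw [derivative_mul]
  simp only [C_add]
  linear_combination (-(1 - X) * g) * this

/-- The three-term recurrence for the moments of the product of two eigenfunctions of the Jacobi
operator. -/
theorem IsJacobiFunctional.eigen_product_recurrence (hl : IsJacobiFunctional a b l) {P Q : ℝ[X]}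
    {p q : ℝ} (hP : jacobiOp a b P = C p * P) (hQ : jacobiOp a b Q = C q * Q) (m : ℕ) :
    (m + 1) * (b ^ 2 - (m + 1) ^ 2) * l (X ^ m * (P * Q))
      + ((2 * m + 3) * (p + q) - (b - (m + 1)) * (m + 1) * (m + a + b + 2)
        - (a + b - (m + 1)) * (m + 2) * (m + 2 + b)) * l (X ^ (m + 1) * (P * Q))
      + ((m + 2) * (a + b - (m + 1)) * (m + 3 + a + b) - 2 * (m + 2) * (p + q)
        - (p - q) ^ 2 / (m + 2)) * l (X ^ (m + 2) * (P * Q)) = 0 := by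
  rw [jacobiOp] at hP hQ
  -- Four families of moments occur: those of PQ, x(1-x)(PQ)', x(1-x)P'Q' and x(1-x)(P'Q - PQ'). The
  -- relations `S`, `T` and `W` express the last three through the first; then `D` becomes the
  -- recurrence.
  have S0 := hl.pearson_X_pow m (P * Q)
  have S1 := hl.pearson_X_pow (m + 1) (P * Q)
  have T0 := hl.pearson_X_pow_succ m (derivative (P * Q))
  have T1 := hl.pearson_X_pow_succ (m + 1) (derivative (P * Q))
  have W := hl.pearson_X_pow_succ (m + 1) (derivative P * Q - P * derivative Q)
  have D := hl.pearson_X_pow_succ m (X * (1 - X) * (derivative P * derivative Q))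
  have eT : X * (1 - X) * derivative (derivative (P * Q))
      + (C (b + 1) - C (a + b + 2) * X) * derivative (P * Q)
      = C (p + q) * (P * Q) + C 2 * (X * (1 - X) * (derivative P * derivative Q)) := by
    have h2 : (C 2 : ℝ[X]) = 2 := rfl
    simp only [derivative_mul, derivative_add, C_add, h2] at hP hQ ⊢
    linear_combination Q * hP + P * hQ
  have eW : X * (1 - X) * derivative (derivative P * Q - P * derivative Q)
      + (C (b + 1) - C (a + b + 2) * X) * (derivative P * Q - P * derivative Q)
      = C (p - q) * (P * Q) := by
    simp only [derivative_mul, derivative_sub, C_sub]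
    linear_combination Q * hP - P * hQ
  -- The two eigenvalue equations remove P'' and Q''. Splitting p and q into half-sum and
  -- half-difference separates the part in (PQ)' from the Wronskian part and closes the system.
  have eD : X ^ (m + 1) * (X * (1 - X) * derivative (X * (1 - X) * (derivative P * derivative Q))
      + (C (b + 1) - C (a + b + 2) * X) * (X * (1 - X) * (derivative P * derivative Q)))
      = C ((p + q) / 2) * (X ^ (m + 1) * (X * (1 - X)) * derivative (P * Q))
        - C ((p - q) / 2) * (X ^ (m + 1) * (X * (1 - X)) * (derivative P * Q - P * derivative Q))
        - C b * (X ^ (m + 1) * (X * (1 - X) * (derivative P * derivative Q)))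
        + C (a + b) * (X ^ (m + 2) * (X * (1 - X) * (derivative P * derivative Q))) := by
    have e1 : p = (p + q) / 2 + (p - q) / 2 := by ring
    have e2 : q = (p + q) / 2 - (p - q) / 2 := by ring
    generalize (p + q) / 2 = v at *
    generalize (p - q) / 2 = w at *
    rw [e1] at hP
    rw [e2] at hQ
    have h2 : (C 2 : ℝ[X]) = 2 := rfl
    simp only [derivative_mul, derivative_sub, derivative_X, derivative_one, C_add, C_sub, C_1, h2]
      at hP hQ ⊢
    clear S0 S1 T0 T1 W D eT eW
    linear_combination (X ^ (m + 1) * (X * (1 - X))) * (derivative Q * hP + derivative P * hQ)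
  have eD' : X ^ m * (X * (1 - X)) * (X * (1 - X) * (derivative P * derivative Q)) =
      X ^ (m + 1) * (X * (1 - X) * (derivative P * derivative Q))
      - X ^ (m + 2) * (X * (1 - X) * (derivative P * derivative Q)) := by ring
  rw [eT, mul_add, map_add, mul_left_comm, map_C_mul_eq, mul_left_comm (X ^ _) (C 2),
    map_C_mul_eq] at T0 T1
  rw [eW, mul_left_comm, map_C_mul_eq] at W
  rw [eD, eD', map_add, map_sub, map_sub, map_sub, map_C_mul_eq, map_C_mul_eq, map_C_mul_eq,
    map_C_mul_eq] at D
  rw [show m + 1 + 1 = m + 2 from rfl] at *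
  push_cast at S1 T1 W
  generalize l (X ^ m * (P * Q)) = A0 at *
  generalize l (X ^ (m + 1) * (P * Q)) = A1 at *
  generalize l (X ^ (m + 2) * (P * Q)) = A2 at *
  generalize l (X ^ m * (X * (1 - X)) * derivative (P * Q)) = s0 at *
  generalize l (X ^ (m + 1) * (X * (1 - X)) * derivative (P * Q)) = s1 at *
  generalize l (X ^ (m + 1) * (X * (1 - X) * (derivative P * derivative Q))) = d1 at *
  generalize l (X ^ (m + 2) * (X * (1 - X) * (derivative P * derivative Q))) = d2 at *
  generalize l (X ^ (m + 1) * (X * (1 - X)) * (derivative P * Q - P * derivative Q)) = w at *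
  have hm : (m : ℝ) + 2 ≠ 0 := by positivity
  obtain rfl : w = -((p - q) * A2) / (m + 2) := by
    rw [eq_div_iff hm]; linear_combination W
  obtain rfl : s0 = (m + a + b + 2) * A1 - (m + b + 1) * A0 := by linear_combination S0
  obtain rfl : s1 = (m + 1 + a + b + 2) * A2 - (m + 1 + b + 1) * A1 := by linear_combination S1
  obtain rfl : d1 = (-(m + 1) * ((m + a + b + 2) * A1 - (m + b + 1) * A0) - (p + q) * A1) / 2 := by
    linear_combination T0 / 2
  obtain rfl : d2 = (-(m + 2) * ((m + 1 + a + b + 2) * A2 - (m + 1 + b + 1) * A1)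
      - (p + q) * A2) / 2 := by
    linear_combination T1 / 2
  clear S0 S1 T0 T1 W eT eW eD eD' hP hQ
  linear_combination -2 * D

/-- The `k`-th moment of the one-point density built from the Jacobi polynomials of degree less
than `n`. -/
noncomputable def densityMoment (a b : ℝ) (l : ℝ[X] →ₗ[ℝ] ℝ) (n k : ℕ) : ℝ :=
  ∑ j ∈ Finset.range n, l (X ^ k * (jacobiPoly a b j * jacobiPoly a b j)) / jacobiSqNorm a b l j

theorem IsJacobiFunctional.densityMoment_zero (hl : IsJacobiFunctional a b l) (n : ℕ) :
    densityMoment a b l n 0 = n := by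
  have : ∀ j ∈ Finset.range n,
      l (X ^ 0 * (jacobiPoly a b j * jacobiPoly a b j)) / jacobiSqNorm a b l j = 1 := by
    intro j _
    rw [pow_zero, one_mul]
    exact div_self (hl.sqNorm_pos j).ne'
  rw [densityMoment, Finset.sum_congr rfl this]
  simp

/-- The diagonal recurrence coefficients are differences of subleading coefficients, so the sum
telescopes. -/
theorem IsJacobiFunctional.densityMoment_one (hl : IsJacobiFunctional a b l) (hs : -1 < a + b)
    (n : ℕ) : densityMoment a b l n 1 = n * (n + b) / (2 * n + a + b) := by
  have : ∀ j ∈ Finset.range n,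
      l (X ^ 1 * (jacobiPoly a b j * jacobiPoly a b j)) / jacobiSqNorm a b l j =
        jacobiSubleading a b j - jacobiSubleading a b (j + 1) := by
    intro j _
    rw [pow_one, hl.map_X_mul_sq hs, mul_div_assoc, div_self (hl.sqNorm_pos j).ne', mul_one]
  rw [densityMoment, Finset.sum_congr rfl this, Finset.sum_range_sub']
  simp [jacobiSubleading, neg_div]

/-- The Christoffel–Darboux formula on the diagonal. -/
theorem IsJacobiFunctional.christoffelDarboux (hl : IsJacobiFunctional a b l) (hs : -1 < a + b)
    (n : ℕ) :
    C (jacobiSqNorm a b l n) * ∑ j ∈ Finset.range (n + 1),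
      C (1 / jacobiSqNorm a b l j) * (jacobiPoly a b j * jacobiPoly a b j) =
    derivative (jacobiPoly a b (n + 1)) * jacobiPoly a b n
      - jacobiPoly a b (n + 1) * derivative (jacobiPoly a b n) := by
  induction n with
  | zero =>
    have h0 : jacobiPoly a b 0 = 1 := (monic_jacobiPoly 0).natDegree_eq_zero.1 (natDegree_jacobiPoly 0)
    have h1 : jacobiPoly a b 1 = X + C (jacobiCoeff a b 1 0) := by
      rw [← coeff_jacobiPoly]
      exact (monic_jacobiPoly 1).eq_X_add_C (natDegree_jacobiPoly 1)
    have := (hl.sqNorm_pos 0).ne'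
    rw [zero_add, Finset.sum_range_one, h1, h0, ← mul_assoc, ← C_mul, mul_one_div_cancel this]
    simp
  | succ n ih =>
    have hn := (hl.sqNorm_pos n).ne'
    have hn1 := (hl.sqNorm_pos (n + 1)).ne'
    have e : (C (jacobiSqNorm a b l (n + 1)) : ℝ[X]) =
        C (jacobiSqNorm a b l (n + 1) / jacobiSqNorm a b l n) * C (jacobiSqNorm a b l n) := by
      rw [← C_mul, div_mul_cancel₀ _ hn]
    rw [Finset.sum_range_succ, mul_add, ← mul_assoc _ (C _) (_ * _), ← C_mul,
      mul_one_div_cancel hn1, e, mul_assoc, ih]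
    have h := hl.three_term hs n
    have h' := congrArg derivative h
    simp only [derivative_mul, derivative_add, derivative_X, derivative_C] at h'
    simp only [C_1]
    -- Pairing the recurrence with its derivative cancels x and the diagonal coefficient: W_{n+1} =
    -- π_{n+1}² + (h_{n+1}/h_n) W_n for the Wronskian W_n = π_{n+1}'π_n - π_{n+1}π_n' and the
    -- squared norms h_n.
    linear_combination jacobiPoly a b (n + 1) * h' - derivative (jacobiPoly a b (n + 1)) * h

/-- The difference of consecutive moments carries the factor x(1-x) that integration by parts
against the Wronskian requires. -/
theorem IsJacobiFunctional.sqNorm_mul_densityMoment_sub (hl : IsJacobiFunctional a b l)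
    (hs : -1 < a + b) (n k : ℕ) :
    jacobiSqNorm a b l n * (densityMoment a b l (n + 1) (k + 1)
        - densityMoment a b l (n + 1) (k + 2)) =
      l (X ^ k * (X * (1 - X)) * (derivative (jacobiPoly a b (n + 1)) * jacobiPoly a b n
        - jacobiPoly a b (n + 1) * derivative (jacobiPoly a b n))) := by
  rw [← hl.christoffelDarboux hs, mul_left_comm, map_C_mul_eq, Finset.mul_sum, map_sum,
    densityMoment, densityMoment, ← Finset.sum_sub_distrib]
  congr 1
  refine Finset.sum_congr rfl fun j _ => ?_
  rw [mul_left_comm _ (C _), map_C_mul_eq, ← sub_div, ← map_sub, div_eq_mul_one_div, mul_comm]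
  congr 2
  ring

/-- The moments of `π_{n+1} π_n` in terms of the moments of the density. -/
theorem IsJacobiFunctional.map_X_pow_mul_jacobiPoly (hl : IsJacobiFunctional a b l)
    (hs : -1 < a + b) (n k : ℕ) :
    (2 * n + 2 + a + b) * l (X ^ k * (jacobiPoly a b (n + 1) * jacobiPoly a b n)) =
      k * (jacobiSqNorm a b l n * (densityMoment a b l (n + 1) k
        - densityMoment a b l (n + 1) (k + 1))) := by
  rcases k with _ | k
  · rw [pow_zero, one_mul, hl.orthogonal hs (Nat.lt_succ_self n).ne']
    simp
  have W := hl.pearson_X_pow_succ k (derivative (jacobiPoly a b (n + 1)) * jacobiPoly a b n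
        - jacobiPoly a b (n + 1) * derivative (jacobiPoly a b n))
  have hP := jacobiOp_jacobiPoly hs (n + 1)
  have hQ := jacobiOp_jacobiPoly hs n
  -- Abel's identity: (x(1-x) w W)' is the eigenvalue difference times π_{n+1}π_n w, for the
  -- Wronskian W and the weight w.
  have eW : X * (1 - X) * derivative (derivative (jacobiPoly a b (n + 1)) * jacobiPoly a b n
        - jacobiPoly a b (n + 1) * derivative (jacobiPoly a b n))
      + (C (b + 1) - C (a + b + 2) * X) * (derivative (jacobiPoly a b (n + 1)) * jacobiPoly a b n
        - jacobiPoly a b (n + 1) * derivative (jacobiPoly a b n))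
      = C (jacobiEigenvalue a b (n + 1) - jacobiEigenvalue a b n)
        * (jacobiPoly a b (n + 1) * jacobiPoly a b n) := by
    rw [jacobiOp] at hP hQ
    simp only [derivative_mul, derivative_sub, C_sub]
    linear_combination jacobiPoly a b n * hP - jacobiPoly a b (n + 1) * hQ
  rw [eW, mul_left_comm, map_C_mul_eq, ← hl.sqNorm_mul_densityMoment_sub hs] at W
  have : jacobiEigenvalue a b (n + 1) - jacobiEigenvalue a b n = -(2 * n + 2 + a + b) := by
    simp only [jacobiEigenvalue]; push_cast; ring
  rw [this] at W
  push_cast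
  linear_combination -W

/-- A starting value of the recurrence: for k = 1 the moment of π_{n+1}π_n is just the squared norm
of π_{n+1}. -/
theorem IsJacobiFunctional.densityMoment_one_sub_two (hl : IsJacobiFunctional a b l)
    (hs : -1 < a + b) {n : ℕ} (hn : n ≠ 0) :
    densityMoment a b l n 1 - densityMoment a b l n 2 =
      n * (n + a) * (n + b) * (n + a + b) /
        ((2 * n + a + b) * ((2 * n + a + b) ^ 2 - 1)) := by
  obtain ⟨n, rfl⟩ := Nat.exists_eq_succ_of_ne_zero hn
  have h := hl.map_X_pow_mul_jacobiPoly hs n 1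
  have hn := (hl.sqNorm_pos n).ne'
  rw [pow_one, hl.map_X_mul_mul_succ hs, ← div_mul_cancel₀ (jacobiSqNorm a b l (n + 1)) hn,
    ← mul_assoc, hl.sqNorm_succ_div hs, mul_comm _ (jacobiSqNorm a b l n),
    mul_left_comm _ (jacobiSqNorm a b l n), Nat.cast_one, one_mul] at h
  have h := mul_left_cancel₀ hn h
  rw [Nat.succ_eq_add_one, ← h]
  have : 2 * ((n : ℝ) + 1) + a + b = 2 * n + 2 + a + b := by ring
  push_cast
  rw [this]
  have : 2 * (n : ℝ) + 2 + a + b ≠ 0 := by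
    have : (0 : ℝ) ≤ n := n.cast_nonneg
    linarith
  generalize 2 * (n : ℝ) + 2 + a + b = N at *
  rw [sq N, mul_assoc N N, mul_div_assoc', mul_div_mul_left _ _ this]

/-- The recurrence in `k` of the differences of the moments of the Jacobi unitary ensemble. -/
theorem IsJacobiFunctional.densityMoment_recurrence (hl : IsJacobiFunctional a b l)
    (hs : -1 < a + b) {n : ℕ} (hn : n ≠ 0) (k : ℕ) :
    (k + 3) * ((2 * n + a + b) ^ 2 - (k + 2) ^ 2)
        * (densityMoment a b l n (k + 2) - densityMoment a b l n (k + 3))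
      - (2 * k + 3) * (((2 * n + a + b) ^ 2 + b ^ 2 - a ^ 2) / 2 - (k + 1) * (k + 2))
        * (densityMoment a b l n (k + 1) - densityMoment a b l n (k + 2))
      + k * (b ^ 2 - (k + 1) ^ 2)
        * (densityMoment a b l n k - densityMoment a b l n (k + 1)) = 0 := by
  obtain ⟨n, rfl⟩ := Nat.exists_eq_succ_of_ne_zero hn
  have h := hl.eigen_product_recurrence (jacobiOp_jacobiPoly hs (n + 1)) (jacobiOp_jacobiPoly hs n) k
  have A0 := hl.map_X_pow_mul_jacobiPoly hs n k
  have A1 := hl.map_X_pow_mul_jacobiPoly hs n (k + 1)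
  have A2 := hl.map_X_pow_mul_jacobiPoly hs n (k + 2)
  have hn := (hl.sqNorm_pos n).ne'
  rw [Nat.succ_eq_add_one]
  have e1 : 2 * (n : ℝ) + 2 + a + b = 2 * ((n + 1 : ℕ) : ℝ) + a + b := by push_cast; ring
  have e2 : (jacobiEigenvalue a b (n + 1) - jacobiEigenvalue a b n) ^ 2 =
      (2 * ((n + 1 : ℕ) : ℝ) + a + b) ^ 2 := by
    simp only [jacobiEigenvalue]; push_cast; ring
  have e3 : jacobiEigenvalue a b (n + 1) + jacobiEigenvalue a b n =
      -((2 * ((n + 1 : ℕ) : ℝ) + a + b) ^ 2 - (a + b) ^ 2 - 2 * (a + b)) / 2 := by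
    simp only [jacobiEigenvalue]; push_cast; ring
  rw [e1] at A0 A1 A2
  rw [e2, e3] at h
  have h2 : (k : ℝ) + 2 ≠ 0 := by positivity
  have h1 : (k : ℝ) + 1 ≠ 0 := by positivity
  generalize (2 * ((n + 1 : ℕ) : ℝ) + a + b) = N at *
  generalize l (X ^ k * (jacobiPoly a b (n + 1) * jacobiPoly a b n)) = B0 at *
  generalize l (X ^ (k + 1) * (jacobiPoly a b (n + 1) * jacobiPoly a b n)) = B1 at *
  generalize l (X ^ (k + 2) * (jacobiPoly a b (n + 1) * jacobiPoly a b n)) = B2 at *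
  simp only [show k + 1 + 1 = k + 2 from rfl, show k + 2 + 1 = k + 3 from rfl] at *
  generalize densityMoment a b l (n + 1) k - densityMoment a b l (n + 1) (k + 1) = D0 at *
  generalize densityMoment a b l (n + 1) (k + 1) - densityMoment a b l (n + 1) (k + 2) = D1 at *
  generalize densityMoment a b l (n + 1) (k + 2) - densityMoment a b l (n + 1) (k + 3) = D2 at *
  push_cast at A1 A2
  -- Passing from `B2` to `D2` multiplies its coefficient by k+2, giving (k+1)(k+3)(N² - (k+2)²).
  -- Thus k+1 is a common factor of all three terms and can be cancelled.
  refine mul_left_cancel₀ (mul_ne_zero (mul_ne_zero hn h1) h2) ?_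
  have h3 : N ^ 2 / ((k : ℝ) + 2) * (k + 2) = N ^ 2 := div_mul_cancel₀ _ h2
  generalize N ^ 2 / ((k : ℝ) + 2) = r at *
  linear_combination (k + 2) * (N * h - (k + 1) * (b ^ 2 - (k + 1) ^ 2) * A0
    - ((2 * k + 3) * (-(N ^ 2 - (a + b) ^ 2 - 2 * (a + b)) / 2) - (b - (k + 1)) * (k + 1)
        * (k + a + b + 2) - (a + b - (k + 1)) * (k + 2) * (k + 2 + b)) * A1
    - ((k + 2) * (a + b - (k + 1)) * (k + 3 + a + b)
        + (k + 2) * (N ^ 2 - (a + b) ^ 2 - 2 * (a + b))) * A2) + r * (k + 2) * A2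
    + (k + 2) * jacobiSqNorm a b l n * D2 * h3

end MomentRecurrence

/-! ### Reduction of the ensemble average to one-variable integrals. -/

section JacobiEnsemble

open Polynomial

variable {a b : ℝ}

/-- The one-variable Jacobi weight `x^b (1-x)^a`. -/
noncomputable def jacobiWeightFun (a b x : ℝ) : ℝ := x ^ b * (1 - x) ^ a

/-- For b ≥ 0 the only possible singularity is at x = 1, where a > -1 suffices. -/
theorem integrableOn_eval_mul_jacobiWeightFun (ha : -1 < a) (hb : 0 ≤ b) (f : ℝ[X]) :
    IntegrableOn (fun x => f.eval x * jacobiWeightFun a b x) (Set.Icc 0 1) := by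
  have h : IntervalIntegrable (fun x : ℝ => (1 - x) ^ a) volume 0 1 := by
    have := ((intervalIntegral.intervalIntegrable_rpow' ha (a := 0) (b := 1)).comp_sub_left 1)
    simpa using this.symm
  have hc : ContinuousOn (fun x : ℝ => f.eval x * x ^ b) (Set.Icc 0 1) :=
    (f.continuous.mul (Real.continuous_rpow_const hb)).continuousOn
  rw [intervalIntegrable_iff_integrableOn_Icc_of_le zero_le_one] at h
  refine (h.continuousOn_mul hc isCompact_Icc).congr_fun (fun x _ => ?_) measurableSet_Icc
  simp only [jacobiWeightFun]
  ring

/-- Integration of polynomials against the Jacobi weight on `[0,1]`. -/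
noncomputable def jacobiFunctional (ha : -1 < a) (hb : 0 ≤ b) : ℝ[X] →ₗ[ℝ] ℝ where
  toFun f := ∫ x in Set.Icc (0 : ℝ) 1, f.eval x * jacobiWeightFun a b x
  map_add' f g := by
    simp only [eval_add, add_mul]
    exact integral_add (integrableOn_eval_mul_jacobiWeightFun ha hb f)
      (integrableOn_eval_mul_jacobiWeightFun ha hb g)
  map_smul' c f := by
    simp only [eval_smul, smul_eq_mul, mul_assoc, RingHom.id_apply]
    exact integral_const_mul _ _

theorem jacobiFunctional_apply (ha : -1 < a) (hb : 0 ≤ b) (f : ℝ[X]) :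
    jacobiFunctional ha hb f = ∫ x in Set.Icc (0 : ℝ) 1, f.eval x * jacobiWeightFun a b x := rfl

theorem jacobiWeightFun_pos {x : ℝ} (hx : x ∈ Set.Ioo (0 : ℝ) 1) : 0 < jacobiWeightFun a b x :=
  mul_pos (Real.rpow_pos_of_pos hx.1 _) (Real.rpow_pos_of_pos (sub_pos.2 hx.2) _)

theorem jacobiWeightFun_nonneg {x : ℝ} (hx : x ∈ Set.Icc (0 : ℝ) 1) : 0 ≤ jacobiWeightFun a b x :=
  mul_nonneg (Real.rpow_nonneg hx.1 _) (Real.rpow_nonneg (sub_nonneg.2 hx.2) _)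

theorem isJacobiFunctional_jacobiFunctional (ha : -1 < a) (hb : 0 ≤ b) :
    IsJacobiFunctional a b (jacobiFunctional ha hb) where
  pearson f := by
    rw [jacobiFunctional_apply, integral_Icc_eq_integral_Ioc,
      ← intervalIntegral.integral_of_le zero_le_one]
    -- This is a primitive of the integrand; it vanishes at both ends because a+1 and b+1 are
    -- positive.
    have hc : ContinuousOn (fun x : ℝ => f.eval x * (x ^ (b + 1) * (1 - x) ^ (a + 1)))
        (Set.Icc 0 1) := by
      refine (f.continuous.mul (.mul ?_ ?_)).continuousOn
      · exact Real.continuous_rpow_const (by linarith)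
      · exact (Real.continuous_rpow_const (by linarith)).comp (continuous_const.sub continuous_id)
    rw [intervalIntegral.integral_eq_sub_of_hasDerivAt_of_le zero_le_one hc]
    · rw [sub_self, Real.zero_rpow (by linarith), Real.zero_rpow (by linarith)]
      simp
    · intro x hx
      have h1 : HasDerivAt (fun x : ℝ => x ^ (b + 1)) ((b + 1) * x ^ b) x := by
        simpa using Real.hasDerivAt_rpow_const (p := b + 1) (Or.inl hx.1.ne')
      have h2 : HasDerivAt (fun x : ℝ => (1 - x) ^ (a + 1)) (-((a + 1) * (1 - x) ^ a)) x := by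
        have h3 := Real.hasDerivAt_rpow_const (p := a + 1) (Or.inl (sub_pos.2 hx.2).ne')
        have := h3.comp x ((hasDerivAt_id x).const_sub 1)
        exact this.congr_deriv (by simp)
      refine ((f.hasDerivAt x).mul (h1.mul h2)).congr_deriv ?_
      simp only [Pi.mul_apply, jacobiWeightFun, eval_add, eval_mul, eval_sub, eval_X, eval_one,
        eval_C]
      rw [Real.rpow_add_one hx.1.ne', Real.rpow_add_one (sub_pos.2 hx.2).ne']
      ring
    · rw [intervalIntegrable_iff_integrableOn_Icc_of_le zero_le_one]
      exact integrableOn_eval_mul_jacobiWeightFun ha hb _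
  pos f hf := by
    rw [jacobiFunctional_apply]
    rw [integral_pos_iff_support_of_nonneg_ae _ (integrableOn_eval_mul_jacobiWeightFun ha hb _)]
    · have hsub : Set.Ioo (0 : ℝ) 1 \ (f.roots.toFinset : Set ℝ) ⊆
          Function.support (fun x => (f * f).eval x * jacobiWeightFun a b x) ∩ Set.Icc 0 1 := by
        intro x hx
        refine ⟨?_, Set.Ioo_subset_Icc_self hx.1⟩
        have h0 : f.eval x ≠ 0 := by
          intro h
          exact hx.2 (by simpa [hf] using h)
        rw [Function.mem_support, eval_mul]
        exact mul_ne_zero (mul_ne_zero h0 h0) (jacobiWeightFun_pos hx.1).ne'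
      rw [Measure.restrict_apply' measurableSet_Icc]
      refine lt_of_lt_of_le ?_ (measure_mono hsub)
      rw [measure_sdiff_null (Finset.measure_zero _ _)]
      simp
    · refine (ae_restrict_iff' measurableSet_Icc).2 (Eventually.of_forall fun x hx => ?_)
      change 0 ≤ (f * f).eval x * jacobiWeightFun a b x
      rw [eval_mul]
      exact mul_nonneg (mul_self_nonneg _) (jacobiWeightFun_nonneg hx)

theorem volume_restrict_unitCube (n : ℕ) :
    (volume : Measure (Fin n → ℝ)).restrict (unitCube n) =
      Measure.pi fun _ => (volume : Measure ℝ).restrict (Set.Icc 0 1) := by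
  rw [← Measure.restrict_pi_pi, unitCube, ← Set.pi_univ_Icc, volume_pi]
  rfl

theorem integrable_prod_eval (ha : -1 < a) (hb : 0 ≤ b) {n : ℕ} (F : Fin n → ℝ[X]) :
    IntegrableOn (fun x => ∏ i, (F i).eval (x i) * jacobiWeightFun a b (x i)) (unitCube n) := by
  rw [IntegrableOn, volume_restrict_unitCube]
  exact Integrable.fintype_prod (f := fun i x => (F i).eval x * jacobiWeightFun a b x)
    fun i => integrableOn_eval_mul_jacobiWeightFun ha hb (F i)

theorem integral_prod_eval (ha : -1 < a) (hb : 0 ≤ b) {n : ℕ} (F : Fin n → ℝ[X]) :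
    ∫ x in unitCube n, ∏ i, (F i).eval (x i) * jacobiWeightFun a b (x i) =
      ∏ i, jacobiFunctional ha hb (F i) := by
  rw [volume_restrict_unitCube,
    integral_fintype_prod_eq_prod (f := fun i x => (F i).eval x * jacobiWeightFun a b x)]
  rfl

/-- Any monic polynomials of degrees 0, ..., n-1 give the Vandermonde determinant; the orthogonal
ones make most terms of the double Leibniz expansion integrate to zero. -/
theorem jacobiWeight_two (n : ℕ) (x : Fin n → ℝ) :
    jacobiWeight 2 a b n x = ∑ σ : Equiv.Perm (Fin n), ∑ τ : Equiv.Perm (Fin n),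
      ((Equiv.Perm.sign σ : ℤ) * (Equiv.Perm.sign τ : ℤ) : ℝ) *
        ∏ i, (jacobiPoly a b (σ i) * jacobiPoly a b (τ i)).eval (x i)
          * jacobiWeightFun a b (x i) := by
  have hV : ∏ j, ∏ l ∈ Finset.Ioi j, |x l - x j| ^ (2 : ℝ) =
      (Matrix.of fun i j : Fin n => (jacobiPoly a b i).eval (x j)).det ^ 2 := by
    rw [← Matrix.det_transpose]
    have := Matrix.det_eval_matrixOfPolynomials_eq_det_vandermonde x
      (fun i : Fin n => jacobiPoly a b i) (fun i => natDegree_jacobiPoly _)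
      (fun i => monic_jacobiPoly _)
    rw [show (Matrix.of fun i j : Fin n => (jacobiPoly a b i).eval (x j)).transpose =
      Matrix.of fun i j : Fin n => (jacobiPoly a b j).eval (x i) from rfl, ← this,
      Matrix.det_vandermonde, ← Finset.prod_pow]
    refine Finset.prod_congr rfl fun j _ => ?_
    rw [← Finset.prod_pow]
    refine Finset.prod_congr rfl fun l _ => ?_
    rw [Real.rpow_two, sq_abs]
  have hw : ∏ j, x j ^ ((2 : ℝ) / 2 * (b + 1) - 1) * (1 - x j) ^ ((2 : ℝ) / 2 * (a + 1) - 1) =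
      ∏ j, jacobiWeightFun a b (x j) := by
    refine Finset.prod_congr rfl fun j _ => ?_
    rw [jacobiWeightFun]
    congr 2 <;> ring
  rw [jacobiWeight, hV, hw, Matrix.det_apply', sq, Finset.sum_mul_sum, Finset.mul_sum]
  refine Finset.sum_congr rfl fun σ _ => ?_
  rw [Finset.mul_sum]
  refine Finset.sum_congr rfl fun τ _ => ?_
  simp only [Matrix.of_apply, eval_mul, Finset.prod_mul_distrib]
  ring

theorem prod_eval_mul_jacobiWeight_two {n : ℕ} (G : Fin n → ℝ[X]) (x : Fin n → ℝ) :
    (∏ i, (G i).eval (x i)) * jacobiWeight 2 a b n x =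
      ∑ σ : Equiv.Perm (Fin n), ∑ τ : Equiv.Perm (Fin n),
      ((Equiv.Perm.sign σ : ℤ) * (Equiv.Perm.sign τ : ℤ) : ℝ) *
        ∏ i, (G i * (jacobiPoly a b (σ i) * jacobiPoly a b (τ i))).eval (x i)
          * jacobiWeightFun a b (x i) := by
  rw [jacobiWeight_two, Finset.mul_sum]
  refine Finset.sum_congr rfl fun σ _ => ?_
  rw [Finset.mul_sum]
  refine Finset.sum_congr rfl fun τ _ => ?_
  rw [mul_left_comm, ← Finset.prod_mul_distrib]
  simp only [eval_mul, mul_assoc]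

theorem integrableOn_prod_eval_mul_jacobiWeight (ha : -1 < a) (hb : 0 ≤ b) {n : ℕ}
    (G : Fin n → ℝ[X]) :
    IntegrableOn (fun x => (∏ i, (G i).eval (x i)) * jacobiWeight 2 a b n x) (unitCube n) := by
  simp only [prod_eval_mul_jacobiWeight_two]
  exact integrable_finsetSum _ fun σ _ => integrable_finsetSum _ fun τ _ =>
    (integrable_prod_eval ha hb _).const_mul _

/-- Expansion of an average over the Jacobi unitary ensemble into one-variable integrals. -/
theorem integral_prod_eval_mul_jacobiWeight (ha : -1 < a) (hb : 0 ≤ b) {n : ℕ}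
    (G : Fin n → ℝ[X]) :
    ∫ x in unitCube n, (∏ i, (G i).eval (x i)) * jacobiWeight 2 a b n x =
      ∑ σ : Equiv.Perm (Fin n), ∑ τ : Equiv.Perm (Fin n),
      ((Equiv.Perm.sign σ : ℤ) * (Equiv.Perm.sign τ : ℤ) : ℝ) *
        ∏ i, jacobiFunctional ha hb (G i * (jacobiPoly a b (σ i) * jacobiPoly a b (τ i))) := by
  simp only [prod_eval_mul_jacobiWeight_two]
  rw [integral_finsetSum _ fun σ _ => integrable_finsetSum _ fun τ _ =>
    (integrable_prod_eval ha hb _).const_mul _]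
  refine Finset.sum_congr rfl fun σ _ => ?_
  rw [integral_finsetSum _ fun τ _ => (integrable_prod_eval ha hb _).const_mul _]
  refine Finset.sum_congr rfl fun τ _ => ?_
  rw [integral_const_mul, integral_prod_eval ha hb]

/-- Distinct permutations differ in at least two places. So a term with σ ≠ τ has an orthogonal
factor away from the one site carrying a test polynomial. -/
theorem exists_ne_apply_ne_of_ne {α : Type*} {σ τ : Equiv.Perm α} (h : σ ≠ τ) (j : α) :
    ∃ i, i ≠ j ∧ σ i ≠ τ i := by
  by_contra! H
  refine h (Equiv.ext fun i => ?_)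
  by_cases hi : i = j
  · subst hi
    by_cases hk : τ.symm (σ i) = i
    · exact (τ.symm_apply_eq.1 hk)
    · have := H _ hk
      rw [Equiv.apply_symm_apply] at this
      exact absurd (σ.injective this) hk
  · exact H i hi

/-- The average of a one-site polynomial over the Jacobi unitary ensemble. -/
theorem integral_eval_mul_jacobiWeight (ha : -1 < a) (hb : 0 ≤ b) {n : ℕ} (g : ℝ[X])
    (j : Fin n) :
    ∫ x in unitCube n, g.eval (x j) * jacobiWeight 2 a b n x =
      ∑ σ : Equiv.Perm (Fin n), (∏ i : Fin n, jacobiSqNorm a b (jacobiFunctional ha hb) i) *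
        (jacobiFunctional ha hb (g * (jacobiPoly a b (σ j) * jacobiPoly a b (σ j))) /
          jacobiSqNorm a b (jacobiFunctional ha hb) (σ j)) := by
  have hl := isJacobiFunctional_jacobiFunctional ha hb
  have hs : -1 < a + b := by linarith
  have h := integral_prod_eval_mul_jacobiWeight ha hb (Function.update 1 j g)
  have e : ∀ x : Fin n → ℝ, ∏ i, ((Function.update (1 : Fin n → ℝ[X]) j g) i).eval (x i) =
      g.eval (x j) := by
    intro x
    rw [Finset.prod_eq_single j]
    · simp
    · intro i _ hi
      simp [Function.update_of_ne hi]
    · simp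
  simp only [e] at h
  rw [h]
  refine Finset.sum_congr rfl fun σ _ => ?_
  rw [Finset.sum_eq_single σ]
  · have hsign : ((Equiv.Perm.sign σ : ℤ) * (Equiv.Perm.sign σ : ℤ) : ℝ) = 1 := by
      rcases Int.units_eq_one_or (Equiv.Perm.sign σ) with h | h <;> simp [h]
    rw [hsign, one_mul, ← Equiv.prod_comp σ fun i : Fin n => jacobiSqNorm a b _ i,
      ← Finset.mul_prod_erase _ _ (Finset.mem_univ j),
      ← Finset.mul_prod_erase _ _ (Finset.mem_univ j), Function.update_self]
    have : ∀ i ∈ Finset.univ.erase j, jacobiFunctional ha hb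
        (Function.update (1 : Fin n → ℝ[X]) j g i * (jacobiPoly a b (σ i) * jacobiPoly a b (σ i)))
        = jacobiSqNorm a b (jacobiFunctional ha hb) (σ i) := by
      intro i hi
      rw [Function.update_of_ne (Finset.ne_of_mem_erase hi), Pi.one_apply, one_mul, jacobiSqNorm]
    rw [Finset.prod_congr rfl this]
    have := (hl.sqNorm_pos (σ j)).ne'
    field_simp
  · intro τ _ hτ
    obtain ⟨i, hi, hne⟩ := exists_ne_apply_ne_of_ne hτ.symm j
    rw [Finset.prod_eq_zero (Finset.mem_univ i), mul_zero]
    rw [Function.update_of_ne hi, Pi.one_apply, one_mul]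
    exact hl.orthogonal hs fun h => hne (Fin.ext h)
  · simp

theorem integrableOn_eval_mul_jacobiWeight (ha : -1 < a) (hb : 0 ≤ b) {n : ℕ} (g : ℝ[X])
    (j : Fin n) :
    IntegrableOn (fun x => g.eval (x j) * jacobiWeight 2 a b n x) (unitCube n) := by
  have h := integrableOn_prod_eval_mul_jacobiWeight ha hb (Function.update 1 j g)
  have e : ∀ x : Fin n → ℝ, ∏ i, ((Function.update (1 : Fin n → ℝ[X]) j g) i).eval (x i) =
      g.eval (x j) := by
    intro x
    rw [Finset.prod_eq_single j]
    · simp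
    · intro i _ hi
      simp [Function.update_of_ne hi]
    · simp
  simpa only [e] using h

theorem integrableOn_jacobiWeight_two (ha : -1 < a) (hb : 0 ≤ b) (n : ℕ) :
    IntegrableOn (jacobiWeight 2 a b n) (unitCube n) := by
  simpa using integrableOn_prod_eval_mul_jacobiWeight ha hb (1 : Fin n → ℝ[X])

theorem jacobiNorm_two (ha : -1 < a) (hb : 0 ≤ b) (n : ℕ) :
    jacobiNorm 2 a b n =
      n.factorial * ∏ i : Fin n, jacobiSqNorm a b (jacobiFunctional ha hb) i := by
  have hl := isJacobiFunctional_jacobiFunctional ha hb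
  have hs : -1 < a + b := by linarith
  have h := integral_prod_eval_mul_jacobiWeight ha hb (1 : Fin n → ℝ[X])
  simp only [Pi.one_apply, eval_one, Finset.prod_const_one, one_mul] at h
  rw [jacobiNorm, h]
  rw [Finset.sum_congr rfl (g := fun _ => ∏ i : Fin n, jacobiSqNorm a b (jacobiFunctional ha hb) i)]
  · simp [Fintype.card_perm]
  · intro σ _
    rw [Finset.sum_eq_single σ]
    · have hsign : ((Equiv.Perm.sign σ : ℤ) * (Equiv.Perm.sign σ : ℤ) : ℝ) = 1 := by
        rcases Int.units_eq_one_or (Equiv.Perm.sign σ) with h | h <;> simp [h]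
      rw [hsign, one_mul, ← Equiv.prod_comp σ fun i : Fin n => jacobiSqNorm a b _ i]
      rfl
    · intro τ _ hτ
      obtain ⟨i, hi⟩ : ∃ i, σ i ≠ τ i := by
        by_contra! H
        exact hτ (Equiv.ext H).symm
      rw [Finset.prod_eq_zero (Finset.mem_univ i), mul_zero]
      exact hl.orthogonal hs fun h => hi (Fin.ext h)
    · simp

theorem jacobiNorm_two_pos (ha : -1 < a) (hb : 0 ≤ b) (n : ℕ) : 0 < jacobiNorm 2 a b n := by
  rw [jacobiNorm_two ha hb]
  exact mul_pos (by exact_mod_cast n.factorial_pos) (Finset.prod_pos fun i _ =>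
    (isJacobiFunctional_jacobiFunctional ha hb).sqNorm_pos i)

/-- The moments of the Jacobi unitary ensemble as moments of the one-point density. -/
theorem jacobiMoment_two (ha : -1 < a) (hb : 0 ≤ b) (k n : ℕ) :
    jacobiMoment 2 a b k n = densityMoment a b (jacobiFunctional ha hb) n k := by
  have hl := isJacobiFunctional_jacobiFunctional ha hb
  rw [jacobiMoment, div_mul_eq_mul_div, one_mul, div_eq_iff (jacobiNorm_two_pos ha hb n).ne']
  have e : ∀ x : Fin n → ℝ, (∑ j, x j ^ k) * jacobiWeight 2 a b n x =
      ∑ j, (X ^ k : ℝ[X]).eval (x j) * jacobiWeight 2 a b n x := by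
    intro x
    simp [Finset.sum_mul]
  simp only [e]
  rw [integral_finsetSum _ fun j _ => integrableOn_eval_mul_jacobiWeight ha hb _ j]
  simp only [integral_eval_mul_jacobiWeight ha hb]
  rw [Finset.sum_comm]
  -- For fixed σ the sum over sites is a sum over degrees, so all n! permutations contribute equally
  -- and n! cancels against the normalisation.
  have hσ : ∀ σ : Equiv.Perm (Fin n), ∑ j : Fin n,
      (∏ i : Fin n, jacobiSqNorm a b (jacobiFunctional ha hb) i) *
        (jacobiFunctional ha hb (X ^ k * (jacobiPoly a b (σ j) * jacobiPoly a b (σ j))) /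
          jacobiSqNorm a b (jacobiFunctional ha hb) (σ j)) =
      (∏ i : Fin n, jacobiSqNorm a b (jacobiFunctional ha hb) i) *
        densityMoment a b (jacobiFunctional ha hb) n k := by
    intro σ
    rw [← Finset.mul_sum, Equiv.sum_comp σ fun j : Fin n =>
      jacobiFunctional ha hb (X ^ k * (jacobiPoly a b j * jacobiPoly a b j)) /
          jacobiSqNorm a b (jacobiFunctional ha hb) j, densityMoment, Finset.sum_range]
  simp only [hσ]
  rw [jacobiNorm_two ha hb, Finset.sum_const, Finset.card_univ, Fintype.card_perm,
    Fintype.card_fin, nsmul_eq_mul]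
  ring

end JacobiEnsemble

/-! ### Calculus of asymptotic expansions in 1/n. -/

section Asymptotics

open PowerSeries

/-- `f n` has the formal power series `φ` in `1/n` as asymptotic expansion. -/
def ExpandsAs (f : ℕ → ℝ) (φ : ℝ⟦X⟧) : Prop :=
  ∀ P : ℕ, ∃ p : Polynomial ℝ, (X : ℝ⟦X⟧) ^ (P + 1) ∣ φ - p ∧
    (fun n : ℕ => f n - p.eval (n : ℝ)⁻¹) =o[atTop] fun n : ℕ => ((n : ℝ)⁻¹) ^ P

theorem isBigO_eval_inv (p : Polynomial ℝ) :
    (fun n : ℕ => p.eval (n : ℝ)⁻¹) =O[atTop] fun _ => (1 : ℝ) :=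
  ((p.continuous.tendsto 0).comp (tendsto_inv_atTop_nhds_zero_nat (𝕜 := ℝ))).isBigO_one ℝ

theorem inv_pow_isBigO_one (P : ℕ) :
    (fun n : ℕ => ((n : ℝ)⁻¹) ^ P) =O[atTop] fun _ => (1 : ℝ) := by
  simpa using isBigO_eval_inv (Polynomial.X ^ P)

theorem isLittleO_eval_inv {p : Polynomial ℝ} {P : ℕ} (h : (X : ℝ⟦X⟧) ^ (P + 1) ∣ (p : ℝ⟦X⟧)) :
    (fun n : ℕ => p.eval (n : ℝ)⁻¹) =o[atTop] fun n : ℕ => ((n : ℝ)⁻¹) ^ P := by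
  have h' : (Polynomial.X : Polynomial ℝ) ^ (P + 1) ∣ p := by
    rw [Polynomial.X_pow_dvd_iff]
    rw [PowerSeries.X_pow_dvd_iff] at h
    intro d hd
    simpa using h d hd
  obtain ⟨q, rfl⟩ := h'
  have h0 : (fun n : ℕ => (n : ℝ)⁻¹) =o[atTop] fun _ => (1 : ℝ) :=
    (Asymptotics.isLittleO_one_iff ℝ).2 (tendsto_inv_atTop_nhds_zero_nat (𝕜 := ℝ))
  have := ((Asymptotics.isBigO_refl (fun n : ℕ => ((n : ℝ)⁻¹) ^ P) atTop).mul_isLittleO h0).mul_isBigO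
    (isBigO_eval_inv q)
  simpa [pow_succ] using this

namespace ExpandsAs

variable {f g : ℕ → ℝ} {φ ψ : ℝ⟦X⟧}

/-- Two admissible truncations differ by a multiple of X^(P+1), which is negligible; hence the
choice of truncation is immaterial. -/
theorem isLittleO (h : ExpandsAs f φ) {P : ℕ} {p : Polynomial ℝ}
    (hp : (X : ℝ⟦X⟧) ^ (P + 1) ∣ φ - p) :
    (fun n : ℕ => f n - p.eval (n : ℝ)⁻¹) =o[atTop] fun n : ℕ => ((n : ℝ)⁻¹) ^ P := by
  obtain ⟨q, hq, hf⟩ := h P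
  have : (X : ℝ⟦X⟧) ^ (P + 1) ∣ ((q - p : Polynomial ℝ) : ℝ⟦X⟧) := by
    have := dvd_sub hp hq
    rwa [sub_sub_sub_cancel_left, ← Polynomial.coe_sub] at this
  refine (hf.add (isLittleO_eval_inv this)).congr_left fun n => ?_
  rw [Polynomial.eval_sub]
  ring

theorem isBigO_one (h : ExpandsAs f φ) : f =O[atTop] fun _ => (1 : ℝ) := by
  obtain ⟨p, -, hf⟩ := h 0
  refine ((hf.isBigO.trans (inv_pow_isBigO_one 0)).add (isBigO_eval_inv p)).congr_left fun n => ?_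
  ring

theorem congr (h : ExpandsAs f φ) (hfg : f =ᶠ[atTop] g) : ExpandsAs g φ := by
  intro P
  obtain ⟨p, hp, hf⟩ := h P
  refine ⟨p, hp, hf.congr' ?_ EventuallyEq.rfl⟩
  filter_upwards [hfg] with n hn
  rw [hn]

theorem polynomial (p : Polynomial ℝ) : ExpandsAs (fun n => p.eval (n : ℝ)⁻¹) p := by
  intro P
  refine ⟨p, by simp, ?_⟩
  simp

theorem sub (hf : ExpandsAs f φ) (hg : ExpandsAs g ψ) :
    ExpandsAs (fun n => f n - g n) (φ - ψ) := by
  intro P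
  obtain ⟨p, hp, hf⟩ := hf P
  obtain ⟨q, hq, hg⟩ := hg P
  refine ⟨p - q, ?_, (hf.sub hg).congr_left fun n => ?_⟩
  · have := dvd_sub hp hq
    rw [Polynomial.coe_sub]
    convert this using 1
    ring
  · rw [Polynomial.eval_sub]
    ring

theorem mul (hf : ExpandsAs f φ) (hg : ExpandsAs g ψ) :
    ExpandsAs (fun n => f n * g n) (φ * ψ) := by
  intro P
  obtain ⟨p, hp, hf⟩ := hf P
  obtain ⟨q, hq, hg'⟩ := hg P
  refine ⟨p * q, ?_, ?_⟩
  · have := dvd_add (hp.mul_right ψ) (hq.mul_left (p : ℝ⟦X⟧))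
    rw [Polynomial.coe_mul]
    convert this using 1
    ring
  · have h1 := hf.mul_isBigO hg.isBigO_one
    have h2 := (isBigO_eval_inv p).mul_isLittleO hg'
    simp only [mul_one, one_mul] at h1 h2
    refine (h1.add h2).congr_left fun n => ?_
    rw [Polynomial.eval_mul]
    ring

theorem dvd_sub_trunc (φ : ℝ⟦X⟧) (P : ℕ) : (X : ℝ⟦X⟧) ^ P ∣ φ - (trunc P φ : Polynomial ℝ) := by
  rw [PowerSeries.X_pow_dvd_iff]
  intro m hm
  rw [map_sub, Polynomial.coeff_coe, coeff_trunc, if_pos hm, sub_self]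

theorem tendsto (hf : ExpandsAs f φ) : Tendsto f atTop (nhds (constantCoeff φ)) := by
  have h := hf.isLittleO (dvd_sub_trunc φ (0 + 1))
  simp only [pow_zero, Asymptotics.isLittleO_one_iff] at h
  have h2 := ((trunc (0 + 1) φ).continuous.tendsto 0).comp
    (tendsto_inv_atTop_nhds_zero_nat (𝕜 := ℝ))
  have h3 := h.add h2
  simp only [Function.comp_def, sub_add_cancel, zero_add] at h3
  convert h3
  rw [← Polynomial.coeff_zero_eq_eval_zero, coeff_trunc]
  simp

/-- Division, in the form needed to solve a recurrence for its top term. The factor g has a nonzero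
limit, so dividing the error by it is harmless. -/
theorem of_mul (hg : ExpandsAs g ψ) (h0 : constantCoeff ψ ≠ 0) {γ : ℝ⟦X⟧}
    (hfg : ExpandsAs (fun n => f n * g n) γ) : ExpandsAs f (γ * ψ⁻¹) := by
  intro P
  refine ⟨trunc (P + 1) (γ * ψ⁻¹), dvd_sub_trunc _ _, ?_⟩
  set p := trunc (P + 1) (γ * ψ⁻¹) with hp
  have h1 := (hfg.sub ((polynomial p).mul hg)).isLittleO (P := P) (p := 0) (by
    have := (dvd_sub_trunc (γ * ψ⁻¹) (P + 1)).mul_right ψ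
    rw [sub_mul, mul_assoc, PowerSeries.inv_mul_cancel _ h0, mul_one] at this
    simpa using this)
  have h2 : (fun n => (g n)⁻¹) =O[atTop] fun _ => (1 : ℝ) := (hg.tendsto.inv₀ h0).isBigO_one ℝ
  refine (h1.mul_isBigO h2).congr' ?_ (by simp)
  filter_upwards [hg.tendsto.eventually_ne h0] with n hn
  field_simp
  simp

theorem hasAsymptoticExpansion (hf : ExpandsAs f φ) :
    HasAsymptoticExpansion f fun p => coeff p φ := by
  intro P
  have h := hf.isLittleO (dvd_sub_trunc φ (P + 1))
  refine (h.congr_left fun n => ?_).congr_right fun n => by simp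
  congr 1
  rw [Polynomial.eval_eq_sum_range' (natDegree_trunc_lt φ P)]
  refine Finset.sum_congr rfl fun p hp => ?_
  rw [coeff_trunc, if_pos (Finset.mem_range.1 hp), inv_pow, div_eq_mul_inv]

end ExpandsAs

end Asymptotics

/-! ### Closed forms of the generating functions and their differential equations. -/

section GeneratingFunction

open PowerSeries

/-- The Euler operator `X d/dX`. -/
noncomputable def eulerOp (F : ℝ⟦X⟧) : ℝ⟦X⟧ := X * d⁄dX ℝ F

theorem coeff_eulerOp (F : ℝ⟦X⟧) (n : ℕ) : coeff n (eulerOp F) = n * coeff n F := by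
  rcases n with _ | n
  · simp [eulerOp]
  · rw [eulerOp, coeff_succ_X_mul, coeff_derivative]
    push_cast
    ring

theorem eulerOp_add (F G : ℝ⟦X⟧) : eulerOp (F + G) = eulerOp F + eulerOp G := by
  simp [eulerOp, mul_add]

theorem eulerOp_C_mul_X (c : ℝ) : eulerOp (C c * X) = C c * X := by
  simp [eulerOp, mul_comm]

theorem eulerOp_C (c : ℝ) : eulerOp (C c) = 0 := by
  simp [eulerOp]

/-- The quadratic polynomial `(1 - X) ((u+1)² - (u-1)² X)`. -/
noncomputable def edgeQuadratic (u : ℝ) : ℝ⟦X⟧ :=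
  (1 - X) * (C ((u + 1) ^ 2) - C ((u - 1) ^ 2) * X)

/-- Half the derivative of `edgeQuadratic`. -/
noncomputable def edgeLinear (u : ℝ) : ℝ⟦X⟧ := C ((u - 1) ^ 2) * X - C (u ^ 2 + 1)

theorem derivative_edgeQuadratic (u : ℝ) : d⁄dX ℝ (edgeQuadratic u) = 2 * edgeLinear u := by
  have : (C 2 : ℝ⟦X⟧) = 2 := rfl
  simp only [edgeQuadratic, edgeLinear, Derivation.leibniz, map_sub, derivative_X, derivative_C,
    smul_eq_mul, map_pow, map_add, map_one, Derivation.map_one_eq_zero, Derivation.leibniz_pow]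
  simp
  ring

theorem derivative_edgeLinear (u : ℝ) : d⁄dX ℝ (edgeLinear u) = C ((u - 1) ^ 2) := by
  rw [edgeLinear, map_sub, Derivation.leibniz, derivative_C, derivative_C, derivative_X]
  simp

variable {u : ℝ} {Y : ℝ⟦X⟧}

/-- Formally Y = Q^(-1/2) with Q the edge quadratic; differentiate QY² = 1 and cancel 2Y. -/
theorem derivative_of_mul_sq_eq_one (hY : edgeQuadratic u * Y ^ 2 = 1) :
    edgeQuadratic u * d⁄dX ℝ Y = -(edgeLinear u * Y) := by
  have hY0 : Y ≠ 0 := by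
    rintro rfl
    simp at hY
  have h := congrArg (d⁄dX ℝ) hY
  rw [Derivation.leibniz, Derivation.leibniz_pow, derivative_edgeQuadratic,
    Derivation.map_one_eq_zero] at h
  simp only [smul_eq_mul, nsmul_eq_mul, Nat.cast_ofNat, Nat.add_one_sub_one, pow_one] at h
  have h2 : (2 * Y) * (edgeQuadratic u * d⁄dX ℝ Y + edgeLinear u * Y) = 0 := by
    linear_combination h
  have h3 : (2 : ℝ⟦X⟧) ≠ 0 := by
    intro h
    have := congrArg (coeff 0) h
    rw [← map_ofNat (C (R := ℝ))] at this
    simp at this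
  exact eq_neg_of_add_eq_zero_left ((mul_eq_zero.1 h2).resolve_left (mul_ne_zero h3 hY0))

/-- Since QY² = 1, every odd power of Y that occurs can be written as Q^k Y^7. Each Euler derivative
lowers k by one and keeps Y^7. The exponent 7 accommodates three derivatives of QY = Q⁴Y⁷ and one of
Y⁵ = QY⁷, so the equations below become polynomial identities. -/
theorem eulerOp_mul_pow_mul_pow (hY : edgeQuadratic u * Y ^ 2 = 1) (c : ℝ⟦X⟧) (k : ℕ) :
    eulerOp (c * edgeQuadratic u ^ (k + 1) * Y ^ 7) =
      X * (d⁄dX ℝ c * edgeQuadratic u + (2 * ((k + 1 : ℕ) : ℝ⟦X⟧) - 7) * c * edgeLinear u)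
        * edgeQuadratic u ^ k * Y ^ 7 := by
  have h := derivative_of_mul_sq_eq_one hY
  simp only [eulerOp, Derivation.leibniz, Derivation.leibniz_pow, derivative_edgeQuadratic,
    smul_eq_mul, nsmul_eq_mul, Nat.add_one_sub_one]
  push_cast
  linear_combination 7 * X * c * edgeQuadratic u ^ k * Y ^ 6 * h

/-- Twice the generating function of the leading coefficients. -/
noncomputable def genZero (u : ℝ) (Y : ℝ⟦X⟧) : ℝ⟦X⟧ :=
  C (u + 1) - C (u - 1) * X - edgeQuadratic u * Y

/-- Twice the generating function of the subleading coefficients. -/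
noncomputable def genOne (a u : ℝ) (Y : ℝ⟦X⟧) : ℝ⟦X⟧ :=
  C a * (1 - C (u + 1) * ((1 - X) * Y))

/-- The polynomial factor of the generating function of the second order coefficients. -/
noncomputable def genTwoFactor (a u : ℝ) : ℝ⟦X⟧ :=
  C (a ^ 2 * u) * (C ((u + 1) ^ 2) - C ((u - 1) ^ 2) * X) - C (u ^ 2) * X

/-- Twice the generating function of the second order coefficients. -/
noncomputable def genTwo (a u : ℝ) (Y : ℝ⟦X⟧) : ℝ⟦X⟧ :=
  -(2 * X * genTwoFactor a u * (1 - X) ^ 2 * Y ^ 5)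

theorem eulerOp_genZero (hY : edgeQuadratic u * Y ^ 2 = 1) :
    eulerOp (genZero u Y) =
      C (1 - u) * X + (-(X * edgeLinear u)) * edgeQuadratic u ^ 3 * Y ^ 7 := by
  have e : genZero u Y = C (u + 1) + C (1 - u) * X + (-1) * edgeQuadratic u ^ (3 + 1) * Y ^ 7 := by
    simp only [genZero, map_sub, map_add, map_one]
    linear_combination (edgeQuadratic u * Y) * (edgeQuadratic u ^ 2 * Y ^ 4
      + edgeQuadratic u * Y ^ 2 + 1) * hY
  rw [e, eulerOp_add, eulerOp_add, eulerOp_C, eulerOp_C_mul_X, eulerOp_mul_pow_mul_pow hY]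
  simp
  ring

theorem eulerOp_eulerOp_genZero (hY : edgeQuadratic u * Y ^ 2 = 1) :
    eulerOp (eulerOp (genZero u Y)) =
      C (1 - u) * X + (X * (X * edgeLinear u ^ 2
        - (edgeLinear u + C ((u - 1) ^ 2) * X) * edgeQuadratic u))
        * edgeQuadratic u ^ 2 * Y ^ 7 := by
  rw [eulerOp_genZero hY, eulerOp_add, eulerOp_C_mul_X, eulerOp_mul_pow_mul_pow hY]
  simp only [map_neg, Derivation.leibniz, derivative_edgeLinear, derivative_X, smul_eq_mul]
  push_cast
  ring

theorem eulerOp_eulerOp_eulerOp_genZero (hY : edgeQuadratic u * Y ^ 2 = 1) :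
    eulerOp (eulerOp (eulerOp (genZero u Y))) =
      C (1 - u) * X + (X * (-((edgeLinear u + 3 * C ((u - 1) ^ 2) * X) * edgeQuadratic u ^ 2)
        - 3 * (X * (X * edgeLinear u ^ 2
        - (edgeLinear u + C ((u - 1) ^ 2) * X) * edgeQuadratic u)) * edgeLinear u))
        * edgeQuadratic u * Y ^ 7 := by
  rw [eulerOp_eulerOp_genZero hY, eulerOp_add, eulerOp_C_mul_X, eulerOp_mul_pow_mul_pow hY]
  simp only [map_sub, map_add, Derivation.leibniz, Derivation.leibniz_pow,
    derivative_edgeLinear, derivative_edgeQuadratic, derivative_X, smul_eq_mul, nsmul_eq_mul,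
    derivative_C]
  push_cast
  ring

theorem genOne_eq (hY : edgeQuadratic u * Y ^ 2 = 1) (a : ℝ) : genOne a u Y =
    C a + (-(C a * C (u + 1) * (1 - X))) * edgeQuadratic u ^ 3 * Y ^ 7 := by
  simp only [genOne]
  linear_combination (C a * C (u + 1) * (1 - X) * Y) * (edgeQuadratic u ^ 2 * Y ^ 4
      + edgeQuadratic u * Y ^ 2 + 1) * hY

theorem eulerOp_genOne (hY : edgeQuadratic u * Y ^ 2 = 1) (a : ℝ) :
    eulerOp (genOne a u Y) = (X * (C a * C (u + 1) * (edgeQuadratic u + (1 - X) * edgeLinear u)))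
      * edgeQuadratic u ^ 2 * Y ^ 7 := by
  rw [genOne_eq hY, eulerOp_add, eulerOp_C, eulerOp_mul_pow_mul_pow hY]
  simp only [map_neg, map_sub, Derivation.leibniz, derivative_X, smul_eq_mul,
    derivative_C, Derivation.map_one_eq_zero]
  push_cast
  ring

theorem genTwo_eq (hY : edgeQuadratic u * Y ^ 2 = 1) (a : ℝ) : genTwo a u Y =
    (-(2 * X * genTwoFactor a u * (1 - X) ^ 2)) * edgeQuadratic u ^ (0 + 1) * Y ^ 7 := by
  simp only [genTwo]
  linear_combination (2 * X * genTwoFactor a u * (1 - X) ^ 2 * Y ^ 5) * hY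

theorem eulerOp_genTwo (hY : edgeQuadratic u * Y ^ 2 = 1) (a : ℝ) :
    eulerOp (genTwo a u Y) = X * (-(2 * genTwoFactor a u * (1 - X) ^ 2
        - 2 * X * (C (a ^ 2 * u) * C ((u - 1) ^ 2) + C (u ^ 2)) * (1 - X) ^ 2
        - 4 * X * genTwoFactor a u * (1 - X)) * edgeQuadratic u
        + 10 * X * genTwoFactor a u * (1 - X) ^ 2 * edgeLinear u) * Y ^ 7 := by
  have h2 : d⁄dX ℝ (2 : ℝ⟦X⟧) = 0 := by
    rw [← map_ofNat (C (R := ℝ)), derivative_C]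
  rw [genTwo_eq hY, eulerOp_mul_pow_mul_pow hY]
  simp only [genTwoFactor, map_neg, map_sub, Derivation.leibniz, Derivation.leibniz_pow,
    derivative_X, smul_eq_mul, nsmul_eq_mul, derivative_C, Derivation.map_one_eq_zero, h2]
  push_cast
  ring

/-- The order n⁰ of the recurrence, with the Euler operator standing for the index. The right side
is the defect in degrees 1 and 2, which the recurrence does not govern. -/
theorem genZero_equation (hY : edgeQuadratic u * Y ^ 2 = 1) :
    C ((u + 1) ^ 2) * eulerOp (genZero u Y)
      - C (u ^ 2 + 1) * (X * (2 * eulerOp (genZero u Y) - genZero u Y))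
      + C ((u - 1) ^ 2) * (X * (X * (eulerOp (genZero u Y) - genZero u Y))) =
    C ((u + 1) ^ 2 * (1 - u) + (u ^ 2 + 1) * (u + 1)) * X
      + C ((u ^ 2 + 1) * (u - 1) - (u - 1) ^ 2 * (u + 1)) * X ^ 2 := by
  have e : genZero u Y = C (u + 1) + C (1 - u) * X - edgeQuadratic u ^ 4 * Y ^ 7 := by
    simp only [genZero, map_sub, map_add, map_one]
    linear_combination (edgeQuadratic u * Y) * (edgeQuadratic u ^ 2 * Y ^ 4
      + edgeQuadratic u * Y ^ 2 + 1) * hY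
  rw [eulerOp_genZero hY, e]
  simp only [edgeQuadratic, edgeLinear, map_add, map_sub, map_mul, map_pow, map_one]
  ring

/-- The order n⁻¹: the same operator acts, and the source comes from the 1/n terms of N² and (N² +
b² - a²)/2. -/
theorem genOne_equation (hY : edgeQuadratic u * Y ^ 2 = 1) (a : ℝ) :
    C ((u + 1) ^ 2) * eulerOp (genOne a u Y)
      - C (u ^ 2 + 1) * (X * (2 * eulerOp (genOne a u Y) - genOne a u Y))
      + C ((u - 1) ^ 2) * (X * (X * (eulerOp (genOne a u Y) - genOne a u Y)))
      + (C (2 * a * (u + 1)) * eulerOp (genZero u Y)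
        - C (a * (u + 1)) * (X * (2 * eulerOp (genZero u Y) - genZero u Y))) =
    C (a * ((u ^ 2 + 1) + 2 * (u + 1) * (1 - u) + (u + 1) ^ 2)) * X
      + C (a * ((u + 1) * (u - 1) - (u - 1) ^ 2)) * X ^ 2 := by
  have e : genZero u Y = C (u + 1) + C (1 - u) * X - edgeQuadratic u ^ 4 * Y ^ 7 := by
    simp only [genZero, map_sub, map_add, map_one]
    linear_combination (edgeQuadratic u * Y) * (edgeQuadratic u ^ 2 * Y ^ 4
      + edgeQuadratic u * Y ^ 2 + 1) * hY
  have h2 : (C 2 : ℝ⟦X⟧) = 2 := rfl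
  rw [eulerOp_genOne hY, eulerOp_genZero hY, e, genOne_eq hY]
  simp only [edgeQuadratic, edgeLinear, map_add, map_sub, map_mul, map_pow, map_one, h2]
  ring

/-- At order n⁻² the coefficients are cubic in the index, hence the third Euler derivatives of
`genZero`. -/
theorem genTwo_equation (hY : edgeQuadratic u * Y ^ 2 = 1) (a : ℝ) :
    C ((u + 1) ^ 2) * eulerOp (genTwo a u Y)
      - C (u ^ 2 + 1) * (X * (2 * eulerOp (genTwo a u Y) - genTwo a u Y))
      + C ((u - 1) ^ 2) * (X * (X * (eulerOp (genTwo a u Y) - genTwo a u Y)))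
      + (C (2 * a * (u + 1)) * eulerOp (genOne a u Y)
        - C (a * (u + 1)) * (X * (2 * eulerOp (genOne a u Y) - genOne a u Y)))
      + (C (a ^ 2) * eulerOp (genZero u Y)
        - (eulerOp (eulerOp (eulerOp (genZero u Y))) - 2 * eulerOp (eulerOp (genZero u Y))
          + eulerOp (genZero u Y))
        + X * (2 * eulerOp (eulerOp (eulerOp (genZero u Y)))
          - 3 * eulerOp (eulerOp (genZero u Y)) + eulerOp (genZero u Y))
        - X * (X * (eulerOp (eulerOp (eulerOp (genZero u Y)))
          - eulerOp (eulerOp (genZero u Y))))) =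
    C (2 * a ^ 2) * X := by
  have h2 : (C 2 : ℝ⟦X⟧) = 2 := rfl
  rw [eulerOp_eulerOp_eulerOp_genZero hY, eulerOp_eulerOp_genZero hY, eulerOp_genOne hY,
    eulerOp_genZero hY, genOne_eq hY, eulerOp_genTwo hY, genTwo_eq hY]
  simp only [genTwoFactor, edgeQuadratic, edgeLinear, map_add, map_sub, map_mul, map_pow, map_one,
    h2]
  ring

end GeneratingFunction

/-! ### Existence of the expansion of the moments. -/

section MomentExpansion

open PowerSeries

/-- The polynomial `c₀ + c₁ X + c₂ X²` as a power series. -/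
noncomputable def quadSeries (c₀ c₁ c₂ : ℝ) : ℝ⟦X⟧ := C c₀ + C c₁ * X + C c₂ * X ^ 2

theorem ExpandsAs.quad (c₀ c₁ c₂ : ℝ) :
    ExpandsAs (fun n => c₀ + c₁ * (n : ℝ)⁻¹ + c₂ * (n : ℝ)⁻¹ ^ 2) (quadSeries c₀ c₁ c₂) := by
  have h := ExpandsAs.polynomial
    (Polynomial.C c₀ + Polynomial.C c₁ * Polynomial.X + Polynomial.C c₂ * Polynomial.X ^ 2)
  simp only [Polynomial.eval_add, Polynomial.eval_mul, Polynomial.eval_pow, Polynomial.eval_C,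
    Polynomial.eval_X, Polynomial.coe_add, Polynomial.coe_mul, Polynomial.coe_pow,
    Polynomial.coe_C, Polynomial.coe_X] at h
  exact h

theorem constantCoeff_quadSeries (c₀ c₁ c₂ : ℝ) :
    constantCoeff (quadSeries c₀ c₁ c₂) = c₀ := by
  simp [quadSeries]

theorem coeff_zero_mul_quadSeries (c₀ c₁ c₂ : ℝ) (φ : ℝ⟦X⟧) :
    coeff 0 (φ * quadSeries c₀ c₁ c₂) = c₀ * coeff 0 φ := by
  simp [quadSeries, mul_comm]

theorem coeff_one_mul_quadSeries (c₀ c₁ c₂ : ℝ) (φ : ℝ⟦X⟧) :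
    coeff 1 (φ * quadSeries c₀ c₁ c₂) = c₀ * coeff 1 φ + c₁ * coeff 0 φ := by
  rw [quadSeries, coeff_mul]
  simp [Finset.Nat.antidiagonal_succ, coeff_X, coeff_X_pow, coeff_C]
  ring

theorem coeff_two_mul_quadSeries (c₀ c₁ c₂ : ℝ) (φ : ℝ⟦X⟧) :
    coeff 2 (φ * quadSeries c₀ c₁ c₂) =
      c₀ * coeff 2 φ + c₁ * coeff 1 φ + c₂ * coeff 0 φ := by
  rw [quadSeries, coeff_mul]
  simp [Finset.Nat.antidiagonal_succ, coeff_X, coeff_X_pow, coeff_C]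
  ring

/-- The expansion in `1/n` of the difference of the moments of order `k` and `k+1`, divided by `n`,
for the weight `x^{(u-1)n} (1-x)^a`. -/
noncomputable def momentDiffSeries (a u : ℝ) : ℕ → ℝ⟦X⟧
  | 0 => quadSeries 1 a 0 * (quadSeries (u + 1) a 0)⁻¹
  | 1 => quadSeries 1 a 0 * quadSeries (u ^ 2) (u * a) 0 *
      (quadSeries (u + 1) a 0 * quadSeries ((u + 1) ^ 2) (2 * a * (u + 1)) (a ^ 2 - 1))⁻¹
  | k + 2 => (momentDiffSeries a u (k + 1) *
          quadSeries ((2 * k + 3) * (u ^ 2 + 1)) ((2 * k + 3) * (a * (u + 1)))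
            (-((2 * k + 3) * ((k + 1) * (k + 2))))
        - momentDiffSeries a u k * quadSeries (k * (u - 1) ^ 2) 0 (-(k * (k + 1) ^ 2))) *
      (quadSeries ((k + 3) * (u + 1) ^ 2) ((k + 3) * (2 * a * (u + 1)))
        ((k + 3) * (a ^ 2 - (k + 2) ^ 2)))⁻¹

/-- The expansion in `1/n` of the moments of order `k` divided by `n`. -/
noncomputable def momentSeries (a u : ℝ) : ℕ → ℝ⟦X⟧
  | 0 => 1
  | k + 1 => momentSeries a u k - momentDiffSeries a u k

variable {a u : ℝ}

theorem momentDiffSeries_zero_mul (hu : 0 < u + 1) :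
    momentDiffSeries a u 0 * quadSeries (u + 1) a 0 = 1 * quadSeries 1 a 0 := by
  rw [momentDiffSeries, mul_assoc, PowerSeries.inv_mul_cancel _ (by
    rw [constantCoeff_quadSeries]; exact hu.ne'), mul_one, one_mul]

theorem momentDiffSeries_one_mul (hu : 0 < u + 1) :
    momentDiffSeries a u 1 * quadSeries (u + 1) a 0 *
      quadSeries ((u + 1) ^ 2) (2 * a * (u + 1)) (a ^ 2 - 1) =
      1 * quadSeries 1 a 0 * quadSeries (u ^ 2) (u * a) 0 := by
  rw [momentDiffSeries, mul_assoc, mul_assoc, PowerSeries.inv_mul_cancel, mul_one, one_mul]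
  rw [map_mul, constantCoeff_quadSeries, constantCoeff_quadSeries]
  positivity

theorem momentDiffSeries_add_two_mul (hu : 0 < u + 1) (k : ℕ) :
    momentDiffSeries a u (k + 2) *
      quadSeries ((k + 3) * (u + 1) ^ 2) ((k + 3) * (2 * a * (u + 1)))
        ((k + 3) * (a ^ 2 - (k + 2) ^ 2)) =
    momentDiffSeries a u (k + 1) *
          quadSeries ((2 * k + 3) * (u ^ 2 + 1)) ((2 * k + 3) * (a * (u + 1)))
            (-((2 * k + 3) * ((k + 1) * (k + 2))))
        - momentDiffSeries a u k * quadSeries (k * (u - 1) ^ 2) 0 (-(k * (k + 1) ^ 2)) := by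
  rw [momentDiffSeries, mul_assoc, PowerSeries.inv_mul_cancel, mul_one]
  rw [constantCoeff_quadSeries]
  positivity

theorem jacobiMoment_zero (ha : -1 < a) {b : ℝ} (hb : 0 ≤ b) (n : ℕ) :
    jacobiMoment 2 a b 0 n = n := by
  rw [jacobiMoment_two ha hb, (isJacobiFunctional_jacobiFunctional ha hb).densityMoment_zero]

theorem paramB_nonneg (hu : 1 < u) (n : ℕ) : 0 ≤ paramB u n := by
  have : paramB u n = (u - 1) * n := by rw [paramB]; ring
  rw [this]
  exact mul_nonneg (by linarith) n.cast_nonneg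

/-- Here b = (u-1)n and N = (u+1)n + a make all coefficients of the recurrence, over n², quadratic
in 1/n. The divisor tends to (k+3)(u+1)² ≠ 0, so the expansion passes from k and k+1 to k+2. -/
theorem expandsAs_momentDiffSeries (ha : -1 < a) (hu : 1 < u) (k : ℕ) :
    ExpandsAs (fun n => (jacobiMoment 2 a (paramB u n) k n
      - jacobiMoment 2 a (paramB u n) (k + 1) n) / n) (momentDiffSeries a u k) := by
  have hu0 : 0 < u + 1 := by linarith
  induction k using Nat.twoStepInduction with
  | zero =>
    refine ExpandsAs.of_mul (ExpandsAs.quad (u + 1) a 0) ?_ ((ExpandsAs.quad 1 a 0).congr ?_)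
    · rw [constantCoeff_quadSeries]; exact hu0.ne'
    filter_upwards [eventually_gt_atTop 0] with n hn
    have hb := paramB_nonneg hu n
    have hn' : (1 : ℝ) ≤ n := by exact_mod_cast hn
    rw [jacobiMoment_zero ha hb, jacobiMoment_two ha hb, zero_add,
      (isJacobiFunctional_jacobiFunctional ha hb).densityMoment_one (by linarith)]
    have hN : 2 * n + a + paramB u n ≠ 0 := by linarith
    have hn0 : (n : ℝ) ≠ 0 := by linarith
    have e : u + 1 + a * (n : ℝ)⁻¹ + 0 * (n : ℝ)⁻¹ ^ 2 = (2 * n + a + paramB u n) / n := by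
      rw [paramB]; field_simp; ring
    rw [e]
    rw [show 2 * (n : ℝ) + a + paramB u n = n + (n + paramB u n) + a by ring] at *
    generalize (n : ℝ) + paramB u n = B at *
    field_simp
    ring
  | one =>
    refine ExpandsAs.of_mul ((ExpandsAs.quad (u + 1) a 0).mul
      (ExpandsAs.quad ((u + 1) ^ 2) (2 * a * (u + 1)) (a ^ 2 - 1))) ?_
      (((ExpandsAs.quad 1 a 0).mul (ExpandsAs.quad (u ^ 2) (u * a) 0)).congr ?_)
    · rw [map_mul, constantCoeff_quadSeries, constantCoeff_quadSeries]
      positivity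
    filter_upwards [eventually_gt_atTop 0] with n hn
    have hb := paramB_nonneg hu n
    have hn' : (1 : ℝ) ≤ n := by exact_mod_cast hn
    rw [jacobiMoment_two ha hb, jacobiMoment_two ha hb,
      (isJacobiFunctional_jacobiFunctional ha hb).densityMoment_one_sub_two (by linarith) hn.ne']
    have hN : 2 * n + a + paramB u n ≠ 0 := by linarith
    have hN1 : (2 * n + a + paramB u n) ^ 2 - 1 ≠ 0 := by
      nlinarith
    have hn0 : (n : ℝ) ≠ 0 := by linarith
    have e : u + 1 + a * (n : ℝ)⁻¹ + 0 * (n : ℝ)⁻¹ ^ 2 = (2 * n + a + paramB u n) / n := by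
      rw [paramB]; field_simp; ring
    have e1 : (u + 1) ^ 2 + 2 * a * (u + 1) * (n : ℝ)⁻¹ + (a ^ 2 - 1) * (n : ℝ)⁻¹ ^ 2 =
        ((2 * n + a + paramB u n) ^ 2 - 1) / n ^ 2 := by
      rw [paramB]; field_simp; ring
    rw [e, e1]
    have e2 : (n : ℝ) + paramB u n = u * n := by rw [paramB]; ring
    have e3 : (n : ℝ) + a + paramB u n = u * n + a := by rw [paramB]; ring
    rw [e2, e3]
    generalize (2 * n + a + paramB u n) ^ 2 - 1 = B at *
    generalize 2 * n + a + paramB u n = A at *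
    field_simp
    ring
  | more k ih0 ih1 =>
    refine ExpandsAs.of_mul (ExpandsAs.quad ((k + 3) * (u + 1) ^ 2)
      ((k + 3) * (2 * a * (u + 1))) ((k + 3) * (a ^ 2 - (k + 2) ^ 2))) ?_
      (((ih1.mul (ExpandsAs.quad ((2 * k + 3) * (u ^ 2 + 1))
        ((2 * k + 3) * (a * (u + 1))) (-((2 * k + 3) * ((k + 1) * (k + 2)))))).sub
        (ih0.mul (ExpandsAs.quad (k * (u - 1) ^ 2) 0
          (-(k * (k + 1) ^ 2))))).congr ?_)
    · rw [constantCoeff_quadSeries]; positivity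
    filter_upwards [eventually_gt_atTop 0] with n hn
    have hb := paramB_nonneg hu n
    have hn' : (1 : ℝ) ≤ n := by exact_mod_cast hn
    have hn0 : (n : ℝ) ≠ 0 := by linarith
    have h := (isJacobiFunctional_jacobiFunctional ha hb).densityMoment_recurrence
      (by linarith) hn.ne' k
    simp only [← jacobiMoment_two ha hb] at h
    simp only [show k + 1 + 1 = k + 2 from rfl, show k + 2 + 1 = k + 3 from rfl]
    generalize jacobiMoment 2 a (paramB u n) k n - jacobiMoment 2 a (paramB u n) (k + 1) n = D0 at *
    generalize jacobiMoment 2 a (paramB u n) (k + 1) n - jacobiMoment 2 a (paramB u n) (k + 2) n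
      = D1 at *
    generalize jacobiMoment 2 a (paramB u n) (k + 2) n - jacobiMoment 2 a (paramB u n) (k + 3) n
      = D2 at *
    rw [paramB] at h
    field_simp
    linear_combination -h

theorem expandsAs_momentSeries (ha : -1 < a) (hu : 1 < u) (k : ℕ) :
    ExpandsAs (fun n => 1 / (n : ℝ) * jacobiMoment 2 a (paramB u n) k n) (momentSeries a u k) := by
  induction k with
  | zero =>
    have h := ExpandsAs.polynomial (1 : Polynomial ℝ)
    rw [Polynomial.coe_one] at h
    refine h.congr ?_
    filter_upwards [eventually_gt_atTop 0] with n hn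
    have hn0 : (n : ℝ) ≠ 0 := by exact_mod_cast hn.ne'
    rw [jacobiMoment_zero ha (paramB_nonneg hu n), one_div_mul_cancel hn0, Polynomial.eval_one]
  | succ k ih =>
    refine (ih.sub (expandsAs_momentDiffSeries ha hu k)).congr (Eventually.of_forall fun n => ?_)
    simp only
    ring

end MomentExpansion

/-! ### Matching the expansion coefficients with the closed forms. -/

section Identification

open PowerSeries

variable {a u : ℝ} {Y : ℝ⟦X⟧}

theorem edgeQuadratic_eq_quadSeries (u : ℝ) :
    edgeQuadratic u = quadSeries ((u + 1) ^ 2) (-2 * (u ^ 2 + 1)) ((u - 1) ^ 2) := by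
  have h2 : (C 2 : ℝ⟦X⟧) = 2 := rfl
  simp only [edgeQuadratic, quadSeries, map_add, map_sub, map_mul, map_pow, map_one, map_neg, h2]
  ring

theorem genTwoFactor_eq_quadSeries (a u : ℝ) :
    genTwoFactor a u =
      quadSeries (a ^ 2 * u * (u + 1) ^ 2) (-(a ^ 2 * u * (u - 1) ^ 2 + u ^ 2)) 0 := by
  simp only [genTwoFactor, quadSeries, map_add, map_sub, map_mul, map_pow, map_one, map_neg,
    map_zero]
  ring

theorem coeff_one_sq (φ : ℝ⟦X⟧) : coeff 1 (φ ^ 2) = 2 * coeff 0 φ * coeff 1 φ := by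
  rw [sq, coeff_mul]
  simp [Finset.Nat.antidiagonal_succ]
  ring

theorem coeff_two_sq (φ : ℝ⟦X⟧) :
    coeff 2 (φ ^ 2) = 2 * coeff 0 φ * coeff 2 φ + coeff 1 φ ^ 2 := by
  rw [sq, coeff_mul]
  simp [Finset.Nat.antidiagonal_succ]
  ring

/-- The constant term selects the sign of the square root; QY² = 1 then determines all further
coefficients. -/
theorem coeff_one_of_mul_sq_eq_one (hu : 0 < u + 1) (hY : edgeQuadratic u * Y ^ 2 = 1)
    (hY0 : coeff 0 Y = 1 / (u + 1)) : coeff 1 Y = (u ^ 2 + 1) / (u + 1) ^ 3 := by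
  have h := congrArg (coeff 1) hY
  rw [mul_comm, edgeQuadratic_eq_quadSeries, coeff_one_mul_quadSeries, coeff_one_sq, coeff_one,
    if_neg one_ne_zero, coeff_zero_eq_constantCoeff_apply, coeff_zero_eq_constantCoeff_apply,
    map_pow] at h
  rw [coeff_zero_eq_constantCoeff_apply] at hY0
  rw [hY0] at h
  field_simp at h ⊢
  linear_combination h / 2

theorem coeff_two_of_mul_sq_eq_one (hu : 0 < u + 1) (hY : edgeQuadratic u * Y ^ 2 = 1)
    (hY0 : coeff 0 Y = 1 / (u + 1)) : coeff 2 Y =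
      (3 * (u ^ 2 + 1) ^ 2 - (u ^ 2 - 1) ^ 2) / (2 * (u + 1) ^ 5) := by
  have h := congrArg (coeff 2) hY
  have hY1 := coeff_one_of_mul_sq_eq_one hu hY hY0
  rw [mul_comm, edgeQuadratic_eq_quadSeries, coeff_two_mul_quadSeries, coeff_one_sq, coeff_two_sq,
    coeff_one, if_neg two_ne_zero, coeff_zero_eq_constantCoeff_apply,
    coeff_zero_eq_constantCoeff_apply, map_pow] at h
  rw [coeff_zero_eq_constantCoeff_apply] at hY0
  rw [hY0, hY1] at h
  field_simp at h ⊢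
  linear_combination h

theorem genZero_recurrence (hY : edgeQuadratic u * Y ^ 2 = 1) (k : ℕ) :
    (k + 3) * (u + 1) ^ 2 * coeff (k + 3) (genZero u Y)
      - (2 * k + 3) * (u ^ 2 + 1) * coeff (k + 2) (genZero u Y)
      + k * (u - 1) ^ 2 * coeff (k + 1) (genZero u Y) = 0 := by
  -- Degree k+3 lies above the polynomial right side, so the recurrence is homogeneous there.
  have h := congrArg (coeff (k + 3)) (genZero_equation hY)
  have h2 : (2 : ℝ⟦X⟧) = C 2 := rfl
  simp only [LinearMap.map_add, LinearMap.map_sub, coeff_C_mul, coeff_succ_X_mul, h2,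
    coeff_eulerOp, coeff_X, coeff_X_pow] at h
  rw [if_neg (by omega), if_neg (by omega)] at h
  push_cast at h
  linear_combination h

theorem genOne_recurrence (hY : edgeQuadratic u * Y ^ 2 = 1) (a : ℝ) (k : ℕ) :
    (k + 3) * (u + 1) ^ 2 * coeff (k + 3) (genOne a u Y)
      - (2 * k + 3) * (u ^ 2 + 1) * coeff (k + 2) (genOne a u Y)
      + k * (u - 1) ^ 2 * coeff (k + 1) (genOne a u Y)
      + 2 * (k + 3) * a * (u + 1) * coeff (k + 3) (genZero u Y)
      - (2 * k + 3) * a * (u + 1) * coeff (k + 2) (genZero u Y) = 0 := by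
  have h := congrArg (coeff (k + 3)) (genOne_equation hY a)
  have h2 : (2 : ℝ⟦X⟧) = C 2 := rfl
  simp only [LinearMap.map_add, LinearMap.map_sub, coeff_C_mul, coeff_succ_X_mul, h2,
    coeff_eulerOp, coeff_X, coeff_X_pow] at h
  rw [if_neg (by omega), if_neg (by omega)] at h
  push_cast at h
  linear_combination h

theorem genTwo_recurrence (hY : edgeQuadratic u * Y ^ 2 = 1) (a : ℝ) (k : ℕ) :
    (k + 3) * (u + 1) ^ 2 * coeff (k + 3) (genTwo a u Y)
      - (2 * k + 3) * (u ^ 2 + 1) * coeff (k + 2) (genTwo a u Y)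
      + k * (u - 1) ^ 2 * coeff (k + 1) (genTwo a u Y)
      + 2 * (k + 3) * a * (u + 1) * coeff (k + 3) (genOne a u Y)
      - (2 * k + 3) * a * (u + 1) * coeff (k + 2) (genOne a u Y)
      + (k + 3) * (a ^ 2 - (k + 2) ^ 2) * coeff (k + 3) (genZero u Y)
      + (2 * k + 3) * (k + 1) * (k + 2) * coeff (k + 2) (genZero u Y)
      - k * (k + 1) ^ 2 * coeff (k + 1) (genZero u Y) = 0 := by
  have h := congrArg (coeff (k + 3)) (genTwo_equation hY a)
  have h2 : (2 : ℝ⟦X⟧) = C 2 := rfl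
  have h3 : (3 : ℝ⟦X⟧) = C 3 := rfl
  simp only [LinearMap.map_add, LinearMap.map_sub, coeff_C_mul, coeff_succ_X_mul, h2, h3,
    coeff_eulerOp, coeff_X] at h
  rw [if_neg (by omega)] at h
  push_cast at h
  linear_combination h

theorem coeff_one_genZero (hu : 0 < u + 1) (hY : edgeQuadratic u * Y ^ 2 = 1)
    (hY0 : coeff 0 Y = 1 / (u + 1)) : coeff 1 (genZero u Y) = 2 / (u + 1) := by
  rw [genZero, mul_comm (edgeQuadratic u), edgeQuadratic_eq_quadSeries, map_sub, map_sub,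
    coeff_one_mul_quadSeries, coeff_one_of_mul_sq_eq_one hu hY hY0, hY0, coeff_C_mul, coeff_C,
    if_neg one_ne_zero, coeff_one_X]
  field_simp
  ring

theorem coeff_two_genZero (hu : 0 < u + 1) (hY : edgeQuadratic u * Y ^ 2 = 1)
    (hY0 : coeff 0 Y = 1 / (u + 1)) : coeff 2 (genZero u Y) = 2 * u ^ 2 / (u + 1) ^ 3 := by
  rw [genZero, mul_comm (edgeQuadratic u), edgeQuadratic_eq_quadSeries, map_sub, map_sub,
    coeff_two_mul_quadSeries, coeff_two_of_mul_sq_eq_one hu hY hY0,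
    coeff_one_of_mul_sq_eq_one hu hY hY0, hY0, coeff_C_mul, coeff_C,
    if_neg two_ne_zero, coeff_X, if_neg (by norm_num)]
  field_simp
  ring

theorem genOne_eq_sub_mul_quadSeries (a u : ℝ) (Y : ℝ⟦X⟧) :
    genOne a u Y = C a - C (a * (u + 1)) * (Y * quadSeries 1 (-1) 0) := by
  simp only [genOne, quadSeries, map_mul, map_one, map_neg, map_zero]
  ring

theorem coeff_one_genOne (hu : 0 < u + 1) (hY : edgeQuadratic u * Y ^ 2 = 1)
    (hY0 : coeff 0 Y = 1 / (u + 1)) (a : ℝ) :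
    coeff 1 (genOne a u Y) = 2 * a * u / (u + 1) ^ 2 := by
  rw [genOne_eq_sub_mul_quadSeries, map_sub, coeff_C_mul, coeff_C, if_neg one_ne_zero,
    coeff_one_mul_quadSeries, coeff_one_of_mul_sq_eq_one hu hY hY0, hY0]
  field_simp
  ring

theorem coeff_two_genOne (hu : 0 < u + 1) (hY : edgeQuadratic u * Y ^ 2 = 1)
    (hY0 : coeff 0 Y = 1 / (u + 1)) (a : ℝ) :
    coeff 2 (genOne a u Y) = 2 * a * u * (1 - u + u ^ 2) / (u + 1) ^ 4 := by
  rw [genOne_eq_sub_mul_quadSeries, map_sub, coeff_C_mul, coeff_C, if_neg two_ne_zero,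
    coeff_two_mul_quadSeries, coeff_two_of_mul_sq_eq_one hu hY hY0,
    coeff_one_of_mul_sq_eq_one hu hY hY0, hY0]
  field_simp
  ring

theorem genTwo_eq_X_mul (a u : ℝ) (Y : ℝ⟦X⟧) :
    genTwo a u Y = X * (C (-2) * (Y ^ 5 * quadSeries 1 (-2) 1 * genTwoFactor a u)) := by
  have h2 : (C 2 : ℝ⟦X⟧) = 2 := rfl
  simp only [genTwo, quadSeries, map_neg, map_one, h2]
  ring

theorem coeff_one_genTwo (hY0 : coeff 0 Y = 1 / (u + 1)) (a : ℝ) :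
    coeff 1 (genTwo a u Y) = -2 * (a ^ 2 * u * (u + 1) ^ 2) / (u + 1) ^ 5 := by
  rw [genTwo_eq_X_mul, genTwoFactor_eq_quadSeries, coeff_succ_X_mul, coeff_C_mul,
    coeff_zero_mul_quadSeries, coeff_zero_mul_quadSeries, coeff_zero_eq_constantCoeff_apply,
    map_pow, ← coeff_zero_eq_constantCoeff_apply, hY0]
  field_simp

theorem coeff_two_genTwo (hu : 0 < u + 1) (hY : edgeQuadratic u * Y ^ 2 = 1)
    (hY0 : coeff 0 Y = 1 / (u + 1)) (a : ℝ) :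
    coeff 2 (genTwo a u Y) = -2 * (-2 * (a ^ 2 * u * (u + 1) ^ 2)
      - (a ^ 2 * u * (u - 1) ^ 2 + u ^ 2) + 5 * (a ^ 2 * u * (u ^ 2 + 1))) / (u + 1) ^ 5 := by
  rw [genTwo_eq_X_mul, genTwoFactor_eq_quadSeries, coeff_succ_X_mul, coeff_C_mul,
    coeff_one_mul_quadSeries, coeff_one_mul_quadSeries, coeff_zero_mul_quadSeries, coeff_one_pow,
    coeff_zero_eq_constantCoeff_apply, map_pow, ← coeff_zero_eq_constantCoeff_apply, hY0,
    coeff_one_of_mul_sq_eq_one hu hY hY0]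
  push_cast
  field_simp
  ring

/-- The first three coefficients of the expansion of the moment differences are generated by
`genZero`, `genOne` and `genTwo`. -/
theorem coeff_momentDiffSeries (hu : 0 < u + 1) (hY : edgeQuadratic u * Y ^ 2 = 1)
    (hY0 : coeff 0 Y = 1 / (u + 1)) (a : ℝ) (k : ℕ) :
    2 * coeff 0 (momentDiffSeries a u k) = coeff (k + 1) (genZero u Y) ∧
    2 * coeff 1 (momentDiffSeries a u k) = coeff (k + 1) (genOne a u Y) ∧
    2 * coeff 2 (momentDiffSeries a u k) = coeff (k + 1) (genTwo a u Y) := by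
  induction k using Nat.twoStepInduction with
  | zero =>
    have h := momentDiffSeries_zero_mul (a := a) hu
    have h0 := congrArg (coeff 0) h
    have h1 := congrArg (coeff 1) h
    have h2 := congrArg (coeff 2) h
    simp only [coeff_zero_mul_quadSeries, coeff_one_mul_quadSeries, coeff_two_mul_quadSeries,
      coeff_one, if_neg one_ne_zero, if_neg two_ne_zero, if_true] at h0 h1 h2
    rw [zero_add, coeff_one_genZero hu hY hY0, coeff_one_genOne hu hY hY0, coeff_one_genTwo hY0]
    generalize coeff 0 (momentDiffSeries a u 0) = d0 at *
    generalize coeff 1 (momentDiffSeries a u 0) = d1 at *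
    generalize coeff 2 (momentDiffSeries a u 0) = d2 at *
    obtain rfl : d0 = 1 / (u + 1) := by field_simp; linear_combination h0
    obtain rfl : d1 = a * u / (u + 1) ^ 2 := by
      field_simp at h1 ⊢; linear_combination h1
    obtain rfl : d2 = -a ^ 2 * u / (u + 1) ^ 3 := by
      field_simp at h2 ⊢; linear_combination h2
    refine ⟨?_, ?_, ?_⟩ <;> field_simp
  | one =>
    have h := momentDiffSeries_one_mul (a := a) hu
    have h0 := congrArg (coeff 0) h
    have h1 := congrArg (coeff 1) h
    have h2 := congrArg (coeff 2) h
    simp only [coeff_zero_mul_quadSeries, coeff_one_mul_quadSeries, coeff_two_mul_quadSeries,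
      coeff_one, if_neg one_ne_zero, if_neg two_ne_zero, if_true] at h0 h1 h2
    rw [show 1 + 1 = 2 from rfl, coeff_two_genZero hu hY hY0, coeff_two_genOne hu hY hY0,
      coeff_two_genTwo hu hY hY0]
    generalize coeff 0 (momentDiffSeries a u 1) = d0 at *
    generalize coeff 1 (momentDiffSeries a u 1) = d1 at *
    generalize coeff 2 (momentDiffSeries a u 1) = d2 at *
    obtain rfl : d0 = u ^ 2 / (u + 1) ^ 3 := by
      field_simp; linear_combination h0
    obtain rfl : d1 = a * u * (1 - u + u ^ 2) / (u + 1) ^ 4 := by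
      field_simp at h1 ⊢; linear_combination h1
    obtain rfl : d2 = -(-2 * (a ^ 2 * u * (u + 1) ^ 2)
      - (a ^ 2 * u * (u - 1) ^ 2 + u ^ 2) + 5 * (a ^ 2 * u * (u ^ 2 + 1))) / (u + 1) ^ 5 := by
      field_simp at h2 ⊢; linear_combination h2
    refine ⟨?_, ?_, ?_⟩ <;> field_simp
  | more k ih0 ih1 =>
    have h := momentDiffSeries_add_two_mul (a := a) hu k
    have h0 := congrArg (coeff 0) h
    have h1 := congrArg (coeff 1) h
    have h2 := congrArg (coeff 2) h
    simp only [map_sub, coeff_zero_mul_quadSeries, coeff_one_mul_quadSeries,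
      coeff_two_mul_quadSeries] at h0 h1 h2
    have g0 := genZero_recurrence hY k
    have g1 := genOne_recurrence hY a k
    have g2 := genTwo_recurrence hY a k
    simp only [show k + 1 + 1 = k + 2 from rfl, show k + 2 + 1 = k + 3 from rfl] at *
    obtain ⟨p0, p1, p2⟩ := ih0
    obtain ⟨q0, q1, q2⟩ := ih1
    have hk : ((k : ℝ) + 3) * (u + 1) ^ 2 ≠ 0 := by positivity
    simp only [← p0, ← q0, ← p1, ← q1, ← p2, ← q2] at g0 g1 g2
    -- The system is triangular: each identified order is substituted into the source of the next.
    have r0 : 2 * coeff 0 (momentDiffSeries a u (k + 2)) = coeff (k + 3) (genZero u Y) := by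
      refine mul_left_cancel₀ hk ?_
      linear_combination 2 * h0 - g0
    rw [← r0] at g1 g2
    have r1 : 2 * coeff 1 (momentDiffSeries a u (k + 2)) = coeff (k + 3) (genOne a u Y) := by
      refine mul_left_cancel₀ hk ?_
      linear_combination 2 * h1 - g1
    rw [← r1] at g2
    refine ⟨r0, r1, mul_left_cancel₀ hk ?_⟩
    linear_combination 2 * h2 - g2

/-- The generating function of the coefficients of `n⁻²`. -/
theorem coeff_two_momentSeries (hu : 0 < u + 1) (hY : edgeQuadratic u * Y ^ 2 = 1)
    (hY0 : coeff 0 Y = 1 / (u + 1)) (a : ℝ) (k : ℕ) :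
    coeff 2 (momentSeries a u k) = coeff k (X * genTwoFactor a u * (1 - X) * Y ^ 5) := by
  induction k with
  | zero => simp [momentSeries, coeff_one]
  | succ k ih =>
    have h := (coeff_momentDiffSeries hu hY hY0 a k).2.2
    -- If F generates the moment coefficients, with zero constant term, their differences are
    -- generated by (X - 1)F.
    have e : genTwo a u Y = C 2 * (X * (X * genTwoFactor a u * (1 - X) * Y ^ 5))
        - C 2 * (X * genTwoFactor a u * (1 - X) * Y ^ 5) := by
      have h2 : (C 2 : ℝ⟦X⟧) = 2 := rfl
      rw [genTwo, h2]
      ring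
    rw [e, map_sub, coeff_C_mul, coeff_C_mul, coeff_succ_X_mul] at h
    rw [momentSeries, map_sub, ih]
    linear_combination -h / 2

end Identification

/-! ### From formal series to principal branches on the unit disc. -/

section Summation

open PowerSeries

/-- The real power series `φ` converges absolutely to `g` on the open unit disc. -/
def SumsTo (φ : ℝ⟦X⟧) (g : ℂ → ℂ) : Prop :=
  ∀ s : ℂ, ‖s‖ < 1 → Summable (fun k => ‖((coeff k φ : ℝ) : ℂ) * s ^ k‖) ∧
    HasSum (fun k => ((coeff k φ : ℝ) : ℂ) * s ^ k) (g s)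

namespace SumsTo

variable {φ ψ : ℝ⟦X⟧} {g h : ℂ → ℂ}

/-- Cauchy product; this is why `SumsTo` carries absolute convergence. -/
theorem mul (hφ : SumsTo φ g) (hψ : SumsTo ψ h) : SumsTo (φ * ψ) fun s => g s * h s := by
  intro s hs
  obtain ⟨h1, h2⟩ := hφ s hs
  obtain ⟨h3, h4⟩ := hψ s hs
  have e : (fun k => ((coeff k (φ * ψ) : ℝ) : ℂ) * s ^ k) = fun k =>
      ∑ p ∈ Finset.HasAntidiagonal.antidiagonal k, (((coeff p.1 φ : ℝ) : ℂ) * s ^ p.1) *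
        (((coeff p.2 ψ : ℝ) : ℂ) * s ^ p.2) := by
    ext k
    rw [coeff_mul, Complex.ofReal_sum, Finset.sum_mul]
    refine Finset.sum_congr rfl fun p hp => ?_
    rw [← Finset.HasAntidiagonal.mem_antidiagonal.1 hp, Complex.ofReal_mul, pow_add]
    ring
  have hs1 := summable_norm_sum_mul_antidiagonal_of_summable_norm h1 h3
  have hs2 := tsum_mul_tsum_eq_tsum_sum_antidiagonal_of_summable_norm h1 h3
  rw [h2.tsum_eq, h4.tsum_eq] at hs2
  have e' := fun k => congrFun e k
  refine ⟨by simpa only [e'] using hs1, ?_⟩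
  rw [e]
  change HasSum _ (g s * h s)
  rw [hs2]
  exact hs1.of_norm.hasSum

theorem sub (hφ : SumsTo φ g) (hψ : SumsTo ψ h) : SumsTo (φ - ψ) fun s => g s - h s := by
  intro s hs
  obtain ⟨h1, h2⟩ := hφ s hs
  obtain ⟨h3, h4⟩ := hψ s hs
  have e : ∀ k, ((coeff k (φ - ψ) : ℝ) : ℂ) * s ^ k =
      ((coeff k φ : ℝ) : ℂ) * s ^ k - ((coeff k ψ : ℝ) : ℂ) * s ^ k := by
    intro k
    rw [map_sub, Complex.ofReal_sub, sub_mul]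
  simp only [e]
  exact ⟨.of_nonneg_of_le (fun _ => norm_nonneg _) (fun _ => norm_sub_le _ _) (h1.add h3),
    h2.sub h4⟩

theorem C_mul_X_pow (c : ℝ) (m : ℕ) : SumsTo (C c * X ^ m) fun s => c * s ^ m := by
  intro s _
  have e : ∀ k, k ≠ m → ((coeff k (C c * X ^ m) : ℝ) : ℂ) * s ^ k = 0 := by
    intro k hk
    simp [coeff_C_mul, coeff_X_pow, hk]
  constructor
  · exact summable_of_ne_finset_zero (s := {m}) fun k hk => by
      rw [e k (by simpa using hk), norm_zero]
  · convert hasSum_single m e using 1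
    simp [coeff_C_mul, coeff_X_pow]

theorem const (c : ℝ) : SumsTo (C c) fun _ => c := by
  simpa using C_mul_X_pow c 0

theorem X : SumsTo X fun s => s := by
  simpa using C_mul_X_pow 1 1

theorem pow (hφ : SumsTo φ g) (n : ℕ) : SumsTo (φ ^ n) fun s => g s ^ n := by
  induction n with
  | zero => simpa using const 1
  | succ n ih => simpa only [pow_succ] using ih.mul hφ

theorem rescale_binomialSeries (r c : ℝ) (hc : |c| ≤ 1) :
    SumsTo (rescale (-c) (PowerSeries.binomialSeries ℝ r)) fun s => (1 - c * s) ^ (r : ℂ) := by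
  intro s hs
  have hcs : ‖-(c * s)‖ < 1 := by
    rw [norm_neg, norm_mul, Complex.norm_real, Real.norm_eq_abs]
    exact (mul_le_of_le_one_left (norm_nonneg _) hc).trans_lt hs
  have hmem : -(c * s) ∈ Metric.eball (0 : ℂ) 1 := by
    rw [← ENNReal.ofReal_one, Metric.eball_ofReal]
    simpa using hcs
  have hp := Complex.one_add_cpow_hasFPowerSeriesOnBall_zero (a := (r : ℂ))
  have e : ∀ k, ((coeff k (rescale (-c) (PowerSeries.binomialSeries ℝ r)) : ℝ) : ℂ) * s ^ k =
      _root_.binomialSeries ℂ (r : ℂ) k fun _ => -(c * s) := by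
    intro k
    rw [binomialSeries_apply, coeff_rescale, binomialSeries_coeff, ← Complex.ofReal_choose]
    simp only [List.ofFn_const, List.prod_replicate, smul_eq_mul, mul_one, Complex.ofReal_mul,
      Complex.ofReal_pow, Complex.ofReal_neg]
    rw [← neg_mul, mul_pow]
    ring
  simp only [e]
  constructor
  · exact FormalMultilinearSeries.summable_norm_apply _ (Metric.eball_subset_eball hp.r_le hmem)
  · have := hp.hasSum hmem
    simpa [sub_eq_add_neg] using this

end SumsTo

/-- The power series of `1 / √((1 - X) ((u+1)² - (u-1)² X))`. -/
noncomputable def edgeSeries (u : ℝ) : ℝ⟦X⟧ :=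
  C (1 / (u + 1)) * rescale (-1) (PowerSeries.binomialSeries ℝ (-1 / 2 : ℝ)) *
    rescale (-((u - 1) / (u + 1)) ^ 2) (PowerSeries.binomialSeries ℝ (-1 / 2 : ℝ))

/-- Exponents of binomial series add, so the square of (1+X)^(-1/2) is the inverse of 1+X; rescaling
X to -cX finishes. -/
theorem one_sub_mul_rescale_binomialSeries_sq (c : ℝ) :
    (1 - C c * X) * rescale (-c) (PowerSeries.binomialSeries ℝ (-1 / 2 : ℝ)) ^ 2 = 1 := by
  have h1 : PowerSeries.binomialSeries ℝ (-1 / 2 : ℝ) ^ 2 = PowerSeries.binomialSeries ℝ (-1 : ℝ) := by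
    rw [sq, ← binomialSeries_add]
    norm_num
  have h2 : (1 + X) * PowerSeries.binomialSeries ℝ (-1 : ℝ) = 1 := by
    have := binomialSeries_nat (R := ℝ) (A := ℝ) 1
    rw [pow_one, Nat.cast_one] at this
    rw [← this, ← binomialSeries_add, add_neg_cancel, binomialSeries_zero]
  have h3 := congrArg (rescale (-c)) h2
  rw [map_mul, map_one, map_add, map_one, rescale_X, map_neg] at h3
  rw [← map_pow, h1]
  linear_combination h3

variable {u : ℝ}

theorem edgeQuadratic_mul_edgeSeries_sq (hu : 0 < u + 1) :
    edgeQuadratic u * edgeSeries u ^ 2 = 1 := by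
  have h1 := one_sub_mul_rescale_binomialSeries_sq 1
  have h2 := one_sub_mul_rescale_binomialSeries_sq (((u - 1) / (u + 1)) ^ 2)
  have e : edgeQuadratic u = (1 - C 1 * X) * (C ((u + 1) ^ 2) *
      (1 - C (((u - 1) / (u + 1)) ^ 2) * X)) := by
    rw [edgeQuadratic, mul_sub (C ((u + 1) ^ 2)), ← mul_assoc (C ((u + 1) ^ 2)), ← map_mul C, ← mul_pow,
      mul_div_cancel₀ _ hu.ne']
    simp
  have h3 : (C ((u + 1) ^ 2) : ℝ⟦X⟧) * C (1 / (u + 1)) ^ 2 = 1 := by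
    rw [← map_pow, ← map_mul C, ← mul_pow, mul_one_div_cancel hu.ne', one_pow, map_one]
  rw [e, edgeSeries]
  generalize rescale (-1) (PowerSeries.binomialSeries ℝ (-1 / 2 : ℝ)) = A at *
  generalize rescale (-((u - 1) / (u + 1)) ^ 2) (PowerSeries.binomialSeries ℝ (-1 / 2 : ℝ)) = B at *
  generalize (C ((u + 1) ^ 2) : ℝ⟦X⟧) = V at *
  generalize (C (1 / (u + 1)) : ℝ⟦X⟧) = W at *
  generalize (1 - C 1 * X : ℝ⟦X⟧) = P at *
  generalize (1 - C (((u - 1) / (u + 1)) ^ 2) * X : ℝ⟦X⟧) = Q at *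
  linear_combination Q * B ^ 2 * V * W ^ 2 * h1 + V * W ^ 2 * h2 + h3

theorem coeff_zero_edgeSeries (u : ℝ) : coeff 0 (edgeSeries u) = 1 / (u + 1) := by
  have h : ∀ c : ℝ,
      constantCoeff (rescale c (PowerSeries.binomialSeries ℝ (-1 / 2 : ℝ))) = 1 := by
    intro c
    rw [← coeff_zero_eq_constantCoeff_apply, coeff_rescale, binomialSeries_coeff]
    simp
  rw [edgeSeries, coeff_zero_eq_constantCoeff_apply, map_mul, map_mul, h, h, constantCoeff_C,
    mul_one, mul_one]

theorem abs_sub_one_div_add_one_sq_le (hu : 0 < u) : |((u - 1) / (u + 1)) ^ 2| ≤ 1 := by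
  have h : 0 < u + 1 := by linarith
  rw [abs_of_nonneg (sq_nonneg _), sq_le_one_iff_abs_le_one, abs_div, abs_of_pos h,
    div_le_one h, abs_le]
  constructor <;> linarith

theorem sumsTo_edgeSeries (hu : 0 < u) :
    SumsTo (edgeSeries u) fun s => ((1 / (u + 1) : ℝ) : ℂ) * (1 - s) ^ ((-1 / 2 : ℝ) : ℂ) *
      (1 - (((u - 1) / (u + 1)) ^ 2 : ℝ) * s) ^ ((-1 / 2 : ℝ) : ℂ) := by
  have h1 := SumsTo.rescale_binomialSeries (-1 / 2) 1 (by simp)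
  have h2 := SumsTo.rescale_binomialSeries (-1 / 2) (((u - 1) / (u + 1)) ^ 2)
    (abs_sub_one_div_add_one_sq_le hu)
  have h := ((SumsTo.const (1 / (u + 1))).mul h1).mul h2
  simpa only [edgeSeries, Complex.ofReal_one, one_mul] using h

theorem cpow_neg_half_pow {z : ℂ} (n : ℕ) :
    (z ^ ((-1 / 2 : ℝ) : ℂ)) ^ n = (z ^ ((n : ℂ) / 2))⁻¹ := by
  rw [← Complex.cpow_nat_mul, ← Complex.cpow_neg]
  congr 1
  push_cast
  ring

/-- A positive real factor leaves the argument unchanged, so it leaves the principal power without a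
branch correction. -/
theorem ofReal_sq_mul_cpow_five_halves {r : ℝ} (hr : 0 < r) {z : ℂ} (hz : z ≠ 0) :
    (((r ^ 2 : ℝ) : ℂ) * z) ^ (5 / 2 : ℂ) = (r : ℂ) ^ 5 * z ^ (5 / 2 : ℂ) := by
  have hr2 : 0 < r ^ 2 := by positivity
  have hr' : (r : ℂ) ≠ 0 := by exact_mod_cast hr.ne'
  rw [Complex.cpow_def_of_ne_zero (mul_ne_zero (by exact_mod_cast hr2.ne') hz),
    Complex.log_ofReal_mul hr2 hz, add_mul, Complex.exp_add, ← Complex.cpow_def_of_ne_zero hz,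
    Real.log_pow]
  congr 1
  rw [← Complex.cpow_natCast, Complex.cpow_def_of_ne_zero hr', ← Complex.ofReal_log hr.le]
  congr 1
  push_cast
  ring

/-- The sum of the generating function on the unit disc. -/
theorem hasSum_coeff_genTwo (a : ℝ) (hu : 0 < u) {s : ℂ} (hs : ‖s‖ < 1) :
    HasSum (fun k => ((coeff k (PowerSeries.X * genTwoFactor a u * (1 - PowerSeries.X)
        * edgeSeries u ^ 5) : ℝ) : ℂ) * s ^ k)
      ((a ^ 2 * u * s * (((u : ℂ) + 1) ^ 2 - s * ((u : ℂ) - 1) ^ 2) - s ^ 2 * (u : ℂ) ^ 2) /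
        ((1 - s) ^ (3 / 2 : ℂ) * (((u : ℂ) + 1) ^ 2 - s * ((u : ℂ) - 1) ^ 2) ^ (5 / 2 : ℂ))) := by
  have hF : SumsTo (genTwoFactor a u) fun s => ((a ^ 2 * u : ℝ) : ℂ) *
      (((u + 1) ^ 2 : ℝ) - ((u - 1) ^ 2 : ℝ) * s) - ((u ^ 2 : ℝ) : ℂ) * s :=
    ((SumsTo.const _).mul ((SumsTo.const _).sub ((SumsTo.const _).mul SumsTo.X))).sub
      ((SumsTo.const _).mul SumsTo.X)
  have h1 : SumsTo (1 - PowerSeries.X) fun s => 1 - s := by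
    simpa using (SumsTo.const 1).sub SumsTo.X
  have h := (((SumsTo.X.mul hF).mul h1).mul ((sumsTo_edgeSeries hu).pow 5) s hs).2
  convert h using 1
  have hu1 : (u : ℂ) + 1 ≠ 0 := by exact_mod_cast (by linarith : u + 1 ≠ 0)
  have hs1 : 1 - s ≠ 0 := by
    intro h0
    rw [← sub_eq_zero.1 h0] at hs
    simp at hs
  set c : ℝ := ((u - 1) / (u + 1)) ^ 2 with hc
  have hcs : (1 : ℂ) - c * s ≠ 0 := by
    intro h0
    have h2 : ‖(c : ℂ) * s‖ < 1 := by
      rw [norm_mul, Complex.norm_real, Real.norm_eq_abs]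
      exact (mul_le_of_le_one_left (norm_nonneg _) (abs_sub_one_div_add_one_sq_le hu)).trans_lt hs
    rw [← sub_eq_zero.1 h0] at h2
    simp at h2
  have hR : ((u : ℂ) + 1) ^ 2 - s * ((u : ℂ) - 1) ^ 2 = (((u + 1) ^ 2 : ℝ) : ℂ) * (1 - c * s) := by
    rw [hc]
    push_cast
    field_simp
  -- The factor 1 - s in the numerator lowers the exponent 5/2 coming from Y⁵ to 3/2.
  have e3 : (1 - s) ^ ((5 : ℕ) / 2 : ℂ) = (1 - s) * (1 - s) ^ (3 / 2 : ℂ) := by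
    rw [show ((5 : ℕ) / 2 : ℂ) = 1 + 3 / 2 by push_cast; norm_num, Complex.cpow_add _ _ hs1,
      Complex.cpow_one]
  beta_reduce
  rw [mul_pow, mul_pow, cpow_neg_half_pow, cpow_neg_half_pow, e3]
  have hR5 : (((u : ℂ) + 1) ^ 2 - s * ((u : ℂ) - 1) ^ 2) ^ (5 / 2 : ℂ) =
      ((u : ℂ) + 1) ^ 5 * (1 - c * s) ^ (5 / 2 : ℂ) := by
    rw [hR, ofReal_sq_mul_cpow_five_halves (by linarith) hcs]
    push_cast
    rfl
  rw [hR5]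
  have n1 : (1 - s) ^ (3 / 2 : ℂ) ≠ 0 := by
    rw [Complex.cpow_ne_zero_iff]; exact Or.inl hs1
  have n2 : (1 - c * s) ^ (5 / 2 : ℂ) ≠ 0 := by
    rw [Complex.cpow_ne_zero_iff]; exact Or.inl hcs
  push_cast
  generalize (1 - s) ^ (3 / 2 : ℂ) = p at *
  generalize (1 - c * s) ^ (5 / 2 : ℂ) = q at *
  field_simp

end Summation

theorem mainTheorem5 (δ : ℝ) (hδ : -2 < δ) :
    ∃ T : ℕ → ℕ → ℝ → ℝ, ∀ u : ℝ, 1 < u →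
      (∀ n : ℕ,
        IntegrableOn (jacobiWeight 2 (paramA 2 δ) (paramB u n) n) (unitCube n) ∧
        0 < jacobiNorm 2 (paramA 2 δ) (paramB u n) n) ∧
      (∀ k : ℕ, HasAsymptoticExpansion
        (fun n : ℕ => 1 / (n : ℝ) * transmissionMoment 2 δ u k n) (fun p => T k p u)) ∧
      (∀ s : ℂ, ‖s‖ < 1 →
        HasSum (fun k : ℕ => (T (k + 1) 2 u : ℂ) * s ^ (k + 1))
          (((δ : ℂ) ^ 2 * u * s * (((u : ℂ) + 1) ^ 2 - s * ((u : ℂ) - 1) ^ 2)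
              - 4 * s ^ 2 * (u : ℂ) ^ 2) /
            (4 * (1 - s) ^ (3 / 2 : ℂ) *
              (((u : ℂ) + 1) ^ 2 - s * ((u : ℂ) - 1) ^ 2) ^ (5 / 2 : ℂ)))) := by
  have hA : paramA 2 δ = δ / 2 := by rw [paramA]; ring
  have ha : -1 < δ / 2 := by linarith
  refine ⟨fun k p u => PowerSeries.coeff p (momentSeries (δ / 2) u k), fun u hu => ⟨fun n => ?_,
    fun k => ?_, fun s hs => ?_⟩⟩
  · rw [hA]
    exact ⟨integrableOn_jacobiWeight_two ha (paramB_nonneg hu n) n,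
      jacobiNorm_two_pos ha (paramB_nonneg hu n) n⟩
  · have h := (expandsAs_momentSeries ha hu k).hasAsymptoticExpansion
    simpa only [transmissionMoment, hA] using h
  · have hu0 : 0 < u := by linarith
    have hu1 : 0 < u + 1 := by linarith
    have h := hasSum_coeff_genTwo (δ / 2) hu0 hs
    simp only [← coeff_two_momentSeries hu1 (edgeQuadratic_mul_edgeSeries_sq hu1)
      (coeff_zero_edgeSeries u)] at h
    -- The term k = 0 drops out: M(0,n)/n = 1 has no n⁻² part.
    have h0 := (hasSum_nat_add_iff' 1).2 h
    have e0 : PowerSeries.coeff 2 (momentSeries (δ / 2) u 0) = 0 := by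
      simp [momentSeries, PowerSeries.coeff_one]
    rw [Finset.sum_range_one, e0, Complex.ofReal_zero, zero_mul, sub_zero] at h0
    refine Eq.subst (motive := fun z => HasSum _ z) ?_ h0
    -- The factors 4 come from a² = δ²/4.
    rw [mul_assoc (4 : ℂ) ((1 - s) ^ (3 / 2 : ℂ)), ← div_div _ (4 : ℂ)]
    congr 1
    push_cast
    ring
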